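/- **Setting.** Let $\xi$ be a measure on $\mathbb R$ and suppose that $\Theta=\{\theta\in\mathbb R:\int|x|e^{\theta x}\,d\xi(x)<\infty\}$ is a nonempty open interval. Let $\mathbf S=\{p_\theta:\theta\in\Theta\}$ be the exponential family of probability measures $dp_\theta(x)=e^{\theta x-b(\theta)}\,d\xi(x)$, where $b$ is twice differentiable and strictly convex on $\Theta$. Let $\mathbf O$ be the (open interval of) means of members of $\mathbf S$, let $\theta(\cdot)$ be the inverse of $\theta\mapsto\mathbb E_{p_\theta}[X]$, and for $m,q\in\mathbf O$ put $$d(m,q)=\mathrm{KL}(p_{\theta(m)},p_{\theta(q)})=b(\theta(q))-b(\theta(m))-b'(\theta(m))(\theta(q)-\theta(m)).$$ For $x\notin\mathbf O$, $q\in\mathbf O$ put $d(x,q)=\sup_{\theta\in\Theta}\{(\theta-\theta(q))x-b(\theta)+b(\theta(q))\}$. Let $X_1,X_2,\dots$ be i.i.d. with law $\nu\in\mathbf S$ and mean $\mu$, and let the costs $c_1,c_2,\dots$ be i.i.d., almost surely positive, with mean $0<\bar c<\infty$, and independent of $(X_i)$. For a budget $C_\delta$ let $\tau_\delta=\sup\{n\ge1:\sum_{i\le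 n}c_i\le C_\delta\}$ ($0$ if there is no such $n$), and write $\hat\mu_n=\frac1n\sum_{i\le n}X_i$. **The policy.** For $u\ge1$ let $\psi(u)=u-\ln u$, with inverse $\psi^{-1}:[1,\infty)\to[1,\infty)$, and put $\tilde\psi_y(x)=e^{1/\psi^{-1}(x)}\psi^{-1}(x)$ if $x\ge\psi^{-1}(1/\ln y)$ and $\tilde\psi_y(x)=y(x-\ln\ln y)$ otherwise; let $$\mathcal T(x)=2\tilde\psi_{3/2}\!\left(\frac{x+\log(2\zeta(2))}{2}\right),\qquad \beta(n,\delta)=3\log(1+\log n)+\mathcal T(\log(1/\delta)).$$ From $n\ge1$ samples and $\delta\in(0,1)$ the policy $\hat\pi_1$ reports the interval with end points $\hat\mu_R(n,\delta)=\sup\{q\in\mathbf O:q>\hat\mu_n,\ n\,d(\hat\mu_n,q)\le\beta(n,\delta)\}$ and $\hat\mu_L(n,\delta)=\inf\{q\in\mathbf O:q<\hat\mu_n,\ n\,d(\hat\mu_n,q)\le\beta(n,\delta)\}$ (the end point is $\hat\mu_n$ if the set is empty); with $n=0$ it reports the interval from $\inf\mathbf O$ to $\sup\mathbf O$. **Theorem.**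 a) $\hat\pi_1$ is valid and stable. Valid: for every $\nu\in\mathbf S$, every cost distribution as above, every budget and every $\delta\in(0,1)$, $\ \mathbb P\big(\mu\in[\hat\mu_L(\tau_\delta,\delta),\hat\mu_R(\tau_\delta,\delta)]\big)\ge1-\delta$. Stable: for every $\nu\in\mathbf S$, every cost distribution as above and all budgets with $C_\delta\to\infty$ as $\delta\to0$ for which $C_\delta/\log(1/\delta)$ has a limit in $[0,\infty]$, the end points $\hat\mu_L(\tau_\delta,\delta)$ and $\hat\mu_R(\tau_\delta,\delta)$ converge in probability to constants $\mu_L\le\mu\le\mu_R$ in $[-\infty,\infty]$. b) If $C_\delta/\log(1/\delta)\to k\in(0,\infty)$, then $\mu_L=\mu_L^*$ and $\mu_R=\mu_R^*$, where $\mu_L^*<\mu<\mu_R^*$ in $\mathbf O$ are the unique solution of $$d(\mu,\mu_R^*)=d(\mu,\mu_L^*)=\frac{\bar c}{k}.$$ Here it is assumed that $\{\theta:\int e^{\theta x}d\xi(x)<\infty\}=\Theta$, or, more generally, that $d(\mu,\cdot)$ takes a value $\ge\bar c/k$ on each side of $\mu$ in $\mathbf O$. c) If $C_\delta/\log(1/\delta)\to\infty$,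 then $\mu_R-\mu_L=0$. -/

import Mathlib

open MeasureTheory ProbabilityTheory Set Filter Topology

universe u

noncomputable section

namespace CIMean

/-! ### Canonical one-parameter exponential families -/

/-- The parameters `θ` with `∫ |x| exp (θ x) dξ(x) < ∞`. -/
def paramSet (ξ : Measure ℝ) : Set ℝ :=
  {θ | Integrable (fun x : ℝ => |x| * Real.exp (θ * x)) ξ}

/-- The measure with density `exp (θ x - b θ)` with respect to `ξ`. -/
def expLaw (ξ : Measure ℝ) (b : ℝ → ℝ) (θ : ℝ) : Measure ℝ :=
  ξ.withDensity fun x => ENNReal.ofReal (Real.exp (θ * x - b θ))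

/-- A canonical single-parameter exponential family with reference measure `ξ` and log-partition
function `b`. The parameter set is automatically an interval; it is assumed open. -/
structure ExpFamily where
  ξ : Measure ℝ
  b : ℝ → ℝ
  isOpen_param : IsOpen (paramSet ξ)
  nonempty_param : (paramSet ξ).Nonempty
  isProbability : ∀ θ ∈ paramSet ξ, IsProbabilityMeasure (expLaw ξ b θ)
  differentiable : ∀ θ ∈ paramSet ξ, DifferentiableAt ℝ b θ
  differentiable_deriv : ∀ θ ∈ paramSet ξ, DifferentiableAt ℝ (deriv b) θ
  strictConvex : StrictConvexOn ℝ (paramSet ξ) b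

namespace ExpFamily

variable (F : ExpFamily)

/-- The parameter set. -/
def Θ : Set ℝ := paramSet F.ξ

/-- The member `p_θ` of the family. -/
def law (θ : ℝ) : Measure ℝ := expLaw F.ξ F.b θ

/-- The mean of `p_θ`. -/
def mean (θ : ℝ) : ℝ := ∫ x, x ∂(F.law θ)

/-- The set of means of the members of the family. -/
def O : Set ℝ := F.mean '' F.Θ

/-- The inverse `μ ↦ θ(μ)` of the mean map. -/
def paramOf (m : ℝ) : ℝ := Function.invFunOn F.mean F.Θ m

/-- The divergence `d(m, q) = KL(p_{θ(m)}, p_{θ(q)})`, for `m, q` in the set of means. -/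
def d (m q : ℝ) : ℝ :=
  F.b (F.paramOf q) - F.b (F.paramOf m)
    - deriv F.b (F.paramOf m) * (F.paramOf q - F.paramOf m)

/-- The divergence with a first argument that may be any real number, as is needed for an empirical
mean (for example the empirical mean `0` of Bernoulli samples). Outside the set of means it is the
rate function `sup_λ (λ x - log E_{p_{θ(q)}} exp (λ X))`, written with `λ = θ - θ(q)`, for which
`log E_{p_{θ(q)}} exp (λ X) = b θ - b (θ(q))`. -/
def dExt (x q : ℝ) : EReal :=
  open Classical in
  if x ∈ F.O then ((F.d x q : ℝ) : EReal)
  else ⨆ θ ∈ F.Θ,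
    (((θ - F.paramOf q) * x - (F.b θ - F.b (F.paramOf q)) : ℝ) : EReal)

/-- The parameter set is the whole natural parameter space `{θ | ∫ exp (θ x) dξ(x) < ∞}`. -/
def IsRegular : Prop :=
  ∀ θ : ℝ, Integrable (fun x : ℝ => Real.exp (θ * x)) F.ξ → θ ∈ F.Θ

/-- On each side of `m`, the function `d(m, ·)` takes a value that is at least `v`. -/
def Reaches (m v : ℝ) : Prop :=
  (∃ q ∈ F.O, q < m ∧ v ≤ F.d m q) ∧ (∃ q ∈ F.O, m < q ∧ v ≤ F.d m q)

/-- `qL < m < qR` are means with `d(m, qR) = d(m, qL) = v`. -/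
def SolvesSystem (m v qL qR : ℝ) : Prop :=
  qL ∈ F.O ∧ qR ∈ F.O ∧ qL < m ∧ m < qR ∧ F.d m qR = v ∧ F.d m qL = v

end ExpFamily

/-! ### The threshold -/

/-- `ψ(u) = u - ln u`. -/
def psi (u : ℝ) : ℝ := u - Real.log u

/-- The inverse of `ψ : [1, ∞) → [1, ∞)`. -/
def psiInv (z : ℝ) : ℝ := Function.invFunOn psi (Ici 1) z

/-- The function `ψ̃_y`. -/
def psiTilde (y x : ℝ) : ℝ :=
  open Classical in
  if psiInv (1 / Real.log y) ≤ x then Real.exp (1 / psiInv x) * psiInv x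
  else y * (x - Real.log (Real.log y))

/-- `ζ(2) = ∑_{n ≥ 1} n⁻²`. -/
def zetaTwo : ℝ := ∑' n : ℕ, 1 / ((n : ℝ) + 1) ^ 2

/-- The function `𝒯`. -/
def calT (x : ℝ) : ℝ := 2 * psiTilde (3 / 2) ((x + Real.log (2 * zetaTwo)) / 2)

/-- The anytime threshold `β(n, δ)`, for `n ≥ 1`. -/
def beta (n : ℕ) (δ : ℝ) : ℝ :=
  3 * Real.log (1 + Real.log (n : ℝ)) + calT (Real.log (1 / δ))

/-! ### Policies -/

/-- A policy reports, from `n` samples and a level `δ`, the end points of an interval; end points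
may be infinite. -/
structure CIPolicy where
  lower : (n : ℕ) → (Fin n → ℝ) → ℝ → EReal
  upper : (n : ℕ) → (Fin n → ℝ) → ℝ → EReal

/-- The sample average. -/
def sampleMean {n : ℕ} (x : Fin n → ℝ) : ℝ := (∑ i, x i) / (n : ℝ)

/-- The policy `π̂₁`. With at least one sample, the upper end point is the largest mean `q` above the
sample average with `n d(μ̂_n, q) ≤ β(n, δ)`: it is written as a supremum of extended reals, which is
the maximum if there is one, and it is the sample average if there is no such `q` (which happens
only if the sample average is outside the set of means). The lower end point is symmetric.
Without any sample every mean is possible, and the interval has the end points of the set of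
means. -/
def piHat (F : ExpFamily) : CIPolicy where
  lower n x δ :=
    if n = 0 then sInf ((fun q : ℝ => (q : EReal)) '' F.O)
    else sInf (insert ((sampleMean x : ℝ) : EReal) ((fun q : ℝ => (q : EReal)) ''
      {q : ℝ | q ∈ F.O ∧ q < sampleMean x ∧
        (n : EReal) * F.dExt (sampleMean x) q ≤ ((beta n δ : ℝ) : EReal)}))
  upper n x δ :=
    if n = 0 then sSup ((fun q : ℝ => (q : EReal)) '' F.O)
    else sSup (insert ((sampleMean x : ℝ) : EReal) ((fun q : ℝ => (q : EReal)) ''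
      {q : ℝ | q ∈ F.O ∧ sampleMean x < q ∧
        (n : EReal) * F.dExt (sampleMean x) q ≤ ((beta n δ : ℝ) : EReal)}))

/-! ### Sampling with random costs -/

/-- `X 0, X 1, …` are i.i.d. with law `ν`, the costs `c 0, c 1, …` are i.i.d. with law `κ`, which is
carried by the positive numbers and has the finite mean `cbar`, and samples and costs are
independent. -/
structure IsCostlySampling {Ω : Type*} [MeasurableSpace Ω] (P : Measure Ω) (X c : ℕ → Ω → ℝ)
    (ν κ : Measure ℝ) (cbar : ℝ) : Prop where
  isProbability : IsProbabilityMeasure P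
  measurable_sample : ∀ i, Measurable (X i)
  measurable_cost : ∀ i, Measurable (c i)
  law_sample : ∀ i, P.map (X i) = ν
  law_cost : ∀ i, P.map (c i) = κ
  indep_sample : iIndepFun X P
  indep_cost : iIndepFun c P
  indep_sample_cost : IndepFun (fun ω i => X i ω) (fun ω i => c i ω) P
  cost_pos : ∀ᵐ y ∂κ, 0 < y
  integrable_cost : Integrable (fun y : ℝ => y) κ
  mean_cost : ∫ y, y ∂κ = cbar

section Policies

variable {Ω : Type*}

/-- The largest number of samples that the budget `B` pays for (`0` if it does not pay for any). -/
def tau (c : ℕ → Ω → ℝ) (B : ℝ) (ω : Ω) : ℕ :=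
  sSup {n : ℕ | 1 ≤ n ∧ ∑ i ∈ Finset.range n, c i ω ≤ B}

/-- The lower end point reported after `τ` samples, with budget `B`. -/
def lowerAt (π : CIPolicy) (X c : ℕ → Ω → ℝ) (B δ : ℝ) (ω : Ω) : EReal :=
  π.lower (tau c B ω) (fun i => X i ω) δ

/-- The upper end point reported after `τ` samples, with budget `B`. -/
def upperAt (π : CIPolicy) (X c : ℕ → Ω → ℝ) (B δ : ℝ) (ω : Ω) : EReal :=
  π.upper (tau c B ω) (fun i => X i ω) δ

variable [MeasurableSpace Ω]

/-- Convergence in probability, as `δ → 0+`, to a constant in `[-∞, ∞]`. -/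
def TendstoInProb (P : Measure Ω) (Y : ℝ → Ω → EReal) (l : EReal) : Prop :=
  ∀ U ∈ 𝓝 l, Tendsto (fun δ => P {ω | Y δ ω ∉ U}) (𝓝[>] 0) (𝓝 0)

/-- With the budgets `C δ`, the end points of the interval reported by `π` converge in probability
to the constants `L ≤ μ ≤ R`. -/
def HasLimitingCI (π : CIPolicy) (P : Measure Ω) (X c : ℕ → Ω → ℝ) (C : ℝ → ℝ) (μ : ℝ)
    (L R : EReal) : Prop :=
  L ≤ (μ : EReal) ∧ (μ : EReal) ≤ R ∧
    TendstoInProb P (fun δ => lowerAt π X c (C δ) δ) L ∧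
    TendstoInProb P (fun δ => upperAt π X c (C δ) δ) R

end Policies

/-- The valid policies for the family `F` under random costs: for all members of the family, cost
distributions and budgets, and every `δ ∈ (0, 1)`, the reported interval contains the mean with
probability at least `1 - δ`. -/
def validPolicies (F : ExpFamily) : Set CIPolicy :=
  {π | ∀ (Ω : Type u) [MeasurableSpace Ω] (P : Measure Ω) (X c : ℕ → Ω → ℝ) (κ : Measure ℝ)
      (cbar θ : ℝ), θ ∈ F.Θ → IsCostlySampling P X c (F.law θ) κ cbar →
      ∀ C : ℝ → ℝ, ∀ δ ∈ Ioo (0 : ℝ) 1,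
        ENNReal.ofReal (1 - δ) ≤
          P {ω | lowerAt π X c (C δ) δ ω ≤ ((F.mean θ : ℝ) : EReal) ∧
            ((F.mean θ : ℝ) : EReal) ≤ upperAt π X c (C δ) δ ω}}

/-- The valid policies that are stable: for all members of the family, cost distributions and
budgets `C δ → ∞` for which `C δ / log (1/δ)` has a limit in `[0, ∞]`, the end points of the
reported interval converge in probability to constants `L ≤ μ ≤ R` in `[-∞, ∞]`. -/
def stablePolicies (F : ExpFamily) : Set CIPolicy :=
  {π | π ∈ validPolicies.{u} F ∧
    ∀ (Ω : Type u) [MeasurableSpace Ω] (P : Measure Ω) (X c : ℕ → Ω → ℝ) (κ : Measure ℝ)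
      (cbar θ : ℝ), θ ∈ F.Θ → IsCostlySampling P X c (F.law θ) κ cbar →
      ∀ C : ℝ → ℝ, Tendsto C (𝓝[>] 0) atTop →
        (∃ k : EReal, Tendsto (fun δ => ((C δ / Real.log (1 / δ) : ℝ) : EReal)) (𝓝[>] 0) (𝓝 k)) →
        ∃ L R : EReal, HasLimitingCI π P X c C (F.mean θ) L R}

end CIMean

end

namespace CIMean

/-! ### Exponential families: mean map, convexity and divergence. -/

namespace ExpFamily

variable (F : ExpFamily)

/-! Validity rests on a bound that is uniform in the number of samples. For fixed `θ` the likelihood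
ratio of `p_θ` against the true `p_θ₀` is a product of i.i.d. factors of mean one, so by Ville's
inequality its logarithm ever reaches `y` with probability at most `exp (-y)`. The divergence `d(x,
mean θ₀)` is the supremum over `θ` of the log-likelihood ratio per sample. On one side of the mean
the sets of `x` where these ratios exceed `v` are nested half-lines, so the supremum over `θ` costs
nothing (`measure_slice_le`). Peeling `n` into slices `z ^ i ≤ n < z ^ (i + 1)`, with the ratio `z`
hidden in the definition of `ψ̃`, gives error `δ / 2` per side (`measure_exists_beta_lt_le`). The
exceptional events range over all `n`, hence cover `n = τ`.

For the limits, `calT x ~ x` and `τ ~ C δ / cbar`, so `β(τ, δ) / τ` tends to `cbar / k`, read as `∞`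
for `k = 0` and `0` for `k = ∞`. Once the sample mean lies in the open set `O`, the reported end
points are those of the level set of `d(μ̂, ·)` at height `β / τ`, and these depend continuously in
`EReal` on centre and height (`tendsto_upperLevel`, `tendsto_lowerLevel`). Egorov's theorem turns
the strong laws into uniform statements off a small event, which yields convergence in probability
(`tendsto_measure_notMem_samplingFilter`). In a regular family every height is reached: if `b`
stayed bounded at a finite end of `Θ`, Fatou's lemma would put that end into the open set `Θ`. -/

lemma isOpen_Θ : IsOpen F.Θ := F.isOpen_param

lemma convex_Θ : Convex ℝ F.Θ := F.strictConvex.1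

lemma isProbability_law {θ : ℝ} (hθ : θ ∈ F.Θ) : IsProbabilityMeasure (F.law θ) :=
  F.isProbability θ hθ

lemma measurable_density (θ : ℝ) :
    Measurable fun x : ℝ => ENNReal.ofReal (Real.exp (θ * x - F.b θ)) := by
  fun_prop

lemma lintegral_density {θ : ℝ} (hθ : θ ∈ F.Θ) :
    ∫⁻ x, ENNReal.ofReal (Real.exp (θ * x - F.b θ)) ∂F.ξ = 1 := by
  have h := (F.isProbability θ hθ).measure_univ
  rwa [expLaw, withDensity_apply _ MeasurableSet.univ, Measure.restrict_univ] at h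

/-- Change of measure: the integrand is the density of `p_θ` with respect to `p_θ₀`. -/
lemma lintegral_tilt {θ₀ θ : ℝ} (hθ : θ ∈ F.Θ) :
    ∫⁻ x, ENNReal.ofReal (Real.exp ((θ - θ₀) * x - (F.b θ - F.b θ₀))) ∂F.law θ₀ = 1 := by
  rw [law, expLaw, lintegral_withDensity_eq_lintegral_mul _ (F.measurable_density θ₀)
    (by fun_prop), ← F.lintegral_density hθ]
  refine lintegral_congr fun x => ?_
  rw [Pi.mul_apply, ← ENNReal.ofReal_mul (Real.exp_pos _).le, ← Real.exp_add]
  ring_nf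

lemma integrable_tilt {θ₀ θ : ℝ} (hθ : θ ∈ F.Θ) :
    Integrable (fun x => Real.exp ((θ - θ₀) * x - (F.b θ - F.b θ₀))) (F.law θ₀) := by
  refine ⟨by fun_prop, ?_⟩
  rw [hasFiniteIntegral_iff_ofReal (ae_of_all _ fun x => (Real.exp_pos _).le),
    F.lintegral_tilt hθ]
  exact ENNReal.one_lt_top

lemma integral_tilt {θ₀ θ : ℝ} (hθ : θ ∈ F.Θ) :
    ∫ x, Real.exp ((θ - θ₀) * x - (F.b θ - F.b θ₀)) ∂F.law θ₀ = 1 := by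
  rw [integral_eq_lintegral_of_nonneg_ae (ae_of_all _ fun x => (Real.exp_pos _).le)
    (by fun_prop), F.lintegral_tilt hθ, ENNReal.toReal_one]

lemma integrable_id_law {θ : ℝ} (hθ : θ ∈ F.Θ) : Integrable (fun x : ℝ => x) (F.law θ) := by
  rw [law, expLaw, integrable_withDensity_iff_integrable_smul' (F.measurable_density θ)
    (ae_of_all _ fun x => ENNReal.ofReal_lt_top)]
  have h : Integrable (fun x : ℝ => |x| * Real.exp (θ * x)) F.ξ := hθ
  refine (h.mul_const (Real.exp (-F.b θ))).mono (by fun_prop) (ae_of_all _ fun x => ?_)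
  rw [ENNReal.toReal_ofReal (Real.exp_pos _).le, smul_eq_mul, sub_eq_add_neg, Real.exp_add]
  simp only [norm_mul, Real.norm_eq_abs, abs_abs, Real.abs_exp]
  exact (by ring_nf; rfl)

/-- The mean of `p_θ` is a subgradient of `b` at `θ`. -/
lemma mean_mul_sub_le {θ₀ θ : ℝ} (hθ₀ : θ₀ ∈ F.Θ) (hθ : θ ∈ F.Θ) :
    F.mean θ₀ * (θ - θ₀) ≤ F.b θ - F.b θ₀ := by
  have := F.isProbability_law hθ₀
  have hi := F.integrable_id_law hθ₀
  -- Integrating `1 + u ≤ exp u` for the log-likelihood ratio `u` takes the place of Jensen's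
  -- inequality.
  have h : ∫ x, ((θ - θ₀) * x - (F.b θ - F.b θ₀ - 1)) ∂F.law θ₀ ≤
      ∫ x, Real.exp ((θ - θ₀) * x - (F.b θ - F.b θ₀)) ∂F.law θ₀ :=
    integral_mono ((hi.const_mul _).sub (integrable_const _)) (F.integrable_tilt hθ) fun x => by
      have := Real.add_one_le_exp ((θ - θ₀) * x - (F.b θ - F.b θ₀))
      dsimp only
      linarith
  rw [F.integral_tilt hθ, integral_sub (hi.const_mul _) (integrable_const _),
    integral_const_mul] at h
  simp only [integral_const, probReal_univ, smul_eq_mul, one_mul] at h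
  change (θ - θ₀) * F.mean θ₀ - _ ≤ 1 at h
  linarith

/-- The weak inequality at the midpoint of `θ₀` and `θ` becomes strict through strict convexity. -/
lemma mean_mul_sub_lt {θ₀ θ : ℝ} (hθ₀ : θ₀ ∈ F.Θ) (hθ : θ ∈ F.Θ) (hne : θ₀ ≠ θ) :
    F.mean θ₀ * (θ - θ₀) < F.b θ - F.b θ₀ := by
  have h2 : (0 : ℝ) < 1 / 2 := by norm_num
  have h := F.strictConvex.2 hθ₀ hθ hne h2 h2 (by norm_num)
  have hm := F.mean_mul_sub_le hθ₀ (F.convex_Θ hθ₀ hθ h2.le h2.le (by norm_num))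
  simp only [smul_eq_mul] at h hm
  linarith

/-- By the subgradient inequality `b t - mean θ * t` is minimal at `t = θ`; no differentiation under
the integral is needed. -/
lemma deriv_b {θ : ℝ} (hθ : θ ∈ F.Θ) : deriv F.b θ = F.mean θ := by
  have hmin : IsLocalMin (fun t => F.b t - F.mean θ * t) θ := by
    filter_upwards [F.isOpen_Θ.mem_nhds hθ] with t ht
    linarith [F.mean_mul_sub_le hθ ht]
  have hd : HasDerivAt (fun t => F.b t - F.mean θ * t) (deriv F.b θ - F.mean θ * 1) θ :=
    (F.differentiable θ hθ).hasDerivAt.sub ((hasDerivAt_id θ).const_mul _)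
  linarith [hmin.hasDerivAt_eq_zero hd]

lemma strictMonoOn_mean : StrictMonoOn F.mean F.Θ := by
  intro s hs t ht hst
  have h1 := F.mean_mul_sub_lt hs ht hst.ne
  have h2 := F.mean_mul_sub_lt ht hs hst.ne'
  nlinarith

lemma continuousOn_mean : ContinuousOn F.mean F.Θ := by
  refine ContinuousOn.congr (f := deriv F.b) (fun θ hθ => ?_) fun θ hθ => (F.deriv_b hθ).symm
  exact (F.differentiable_deriv θ hθ).continuousAt.continuousWithinAt

lemma mean_mem_O {θ : ℝ} (hθ : θ ∈ F.Θ) : F.mean θ ∈ F.O := mem_image_of_mem _ hθ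

lemma ordConnected_O : F.O.OrdConnected :=
  (F.convex_Θ.isPreconnected.image _ F.continuousOn_mean).ordConnected

lemma isOpen_O : IsOpen F.O := by
  rw [isOpen_iff_mem_nhds]
  rintro _ ⟨θ, hθ, rfl⟩
  obtain ⟨l, r, ⟨hl, hr⟩, hlr⟩ := mem_nhds_iff_exists_Ioo_subset.1 (F.isOpen_Θ.mem_nhds hθ)
  have hs : (l + θ) / 2 ∈ F.Θ := hlr ⟨by linarith, by linarith⟩
  have ht : (θ + r) / 2 ∈ F.Θ := hlr ⟨by linarith, by linarith⟩
  exact mem_of_superset (Icc_mem_nhds (F.strictMonoOn_mean hs hθ (by linarith))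
    (F.strictMonoOn_mean hθ ht (by linarith)))
    (F.ordConnected_O.out (F.mean_mem_O hs) (F.mean_mem_O ht))

lemma paramOf_mem {m : ℝ} (hm : m ∈ F.O) : F.paramOf m ∈ F.Θ := Function.invFunOn_mem hm

lemma mean_paramOf {m : ℝ} (hm : m ∈ F.O) : F.mean (F.paramOf m) = m := Function.invFunOn_eq hm

lemma paramOf_mean {θ : ℝ} (hθ : θ ∈ F.Θ) : F.paramOf (F.mean θ) = θ :=
  F.strictMonoOn_mean.injOn (F.paramOf_mem (F.mean_mem_O hθ)) hθ
    (F.mean_paramOf (F.mean_mem_O hθ))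

lemma strictMonoOn_paramOf : StrictMonoOn F.paramOf F.O := by
  intro s hs t ht hst
  rw [← F.strictMonoOn_mean.lt_iff_lt (F.paramOf_mem hs) (F.paramOf_mem ht),
    F.mean_paramOf hs, F.mean_paramOf ht]
  exact hst

lemma image_paramOf : F.paramOf '' F.O = F.Θ := by
  ext θ
  constructor
  · rintro ⟨m, hm, rfl⟩
    exact F.paramOf_mem hm
  · exact fun hθ => ⟨_, F.mean_mem_O hθ, F.paramOf_mean hθ⟩

lemma continuousAt_paramOf {m : ℝ} (hm : m ∈ F.O) : ContinuousAt F.paramOf m := by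
  refine F.strictMonoOn_paramOf.continuousAt_of_image_mem_nhds (F.isOpen_O.mem_nhds hm) ?_
  rw [image_paramOf]
  exact F.isOpen_Θ.mem_nhds (F.paramOf_mem hm)

lemma d_eq {m : ℝ} (hm : m ∈ F.O) (q : ℝ) :
    F.d m q = F.b (F.paramOf q) - F.b (F.paramOf m) - m * (F.paramOf q - F.paramOf m) := by
  rw [d, F.deriv_b (F.paramOf_mem hm), F.mean_paramOf hm]

@[simp] lemma d_self (m : ℝ) : F.d m m = 0 := by simp [d]

/-- With `θ_q`, `θ_r` the parameters of `q`, `r`, the increment is `[b θ_r - b θ_q - q (θ_r - θ_q)]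
+ (q - m) (θ_r - θ_q)`: the bracket is positive by the strict subgradient inequality, the rest
nonnegative. -/
lemma d_lt_d_of_lt {m q r : ℝ} (hm : m ∈ F.O) (hq : q ∈ F.O) (hr : r ∈ F.O) (hmq : m ≤ q)
    (hqr : q < r) : F.d m q < F.d m r := by
  have h := F.mean_mul_sub_lt (F.paramOf_mem hq) (F.paramOf_mem hr)
    (F.strictMonoOn_paramOf hq hr hqr).ne
  have hlt := F.strictMonoOn_paramOf hq hr hqr
  rw [F.mean_paramOf hq] at h
  rw [F.d_eq hm, F.d_eq hm]
  nlinarith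

lemma d_lt_d_of_gt {m q r : ℝ} (hm : m ∈ F.O) (hq : q ∈ F.O) (hr : r ∈ F.O) (hmq : q ≤ m)
    (hqr : r < q) : F.d m q < F.d m r := by
  have h := F.mean_mul_sub_lt (F.paramOf_mem hq) (F.paramOf_mem hr)
    (F.strictMonoOn_paramOf hr hq hqr).ne'
  have hlt := F.strictMonoOn_paramOf hr hq hqr
  rw [F.mean_paramOf hq] at h
  rw [F.d_eq hm, F.d_eq hm]
  nlinarith

lemma continuousAt_b_paramOf {m : ℝ} (hm : m ∈ F.O) :
    ContinuousAt (fun x => F.b (F.paramOf x)) m :=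
  (F.differentiable _ (F.paramOf_mem hm)).continuousAt.comp (F.continuousAt_paramOf hm)

lemma continuousAt_d_left {m : ℝ} (hm : m ∈ F.O) (q : ℝ) : ContinuousAt (fun x => F.d x q) m := by
  have hc : ContinuousAt (fun x => F.b (F.paramOf q) - F.b (F.paramOf x)
      - x * (F.paramOf q - F.paramOf x)) m :=
    (continuousAt_const.sub (F.continuousAt_b_paramOf hm)).sub
      (continuousAt_id.mul (continuousAt_const.sub (F.continuousAt_paramOf hm)))
  refine hc.congr ?_
  filter_upwards [F.isOpen_O.mem_nhds hm] with x hx using (F.d_eq hx q).symm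

lemma continuousOn_d_right (m : ℝ) : ContinuousOn (F.d m) F.O := fun _ hq =>
  (((F.continuousAt_b_paramOf hq).sub continuousAt_const).sub
    (continuousAt_const.mul
      ((F.continuousAt_paramOf hq).sub continuousAt_const))).continuousWithinAt

lemma dExt_of_mem {x : ℝ} (hx : x ∈ F.O) (q : ℝ) : F.dExt x q = ((F.d x q : ℝ) : EReal) := by
  rw [dExt, if_pos hx]

/-- A value below the extended divergence is exceeded by a log-likelihood ratio. -/
lemma exists_lt_of_lt_dExt {θ₀ x v : ℝ} (hθ₀ : θ₀ ∈ F.Θ)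
    (h : (v : EReal) < F.dExt x (F.mean θ₀)) :
    ∃ θ ∈ F.Θ, v < (θ - θ₀) * x - (F.b θ - F.b θ₀) := by
  by_cases hx : x ∈ F.O
  · rw [F.dExt_of_mem hx, EReal.coe_lt_coe_iff, F.d_eq hx, F.paramOf_mean hθ₀] at h
    exact ⟨F.paramOf x, F.paramOf_mem hx, by linarith⟩
  · rw [dExt, if_neg hx, F.paramOf_mean hθ₀] at h
    simp only [lt_iSup_iff, EReal.coe_lt_coe_iff] at h
    obtain ⟨θ, hθ, h⟩ := h
    exact ⟨θ, hθ, h⟩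

/-- A sample mean above the true mean can only favour larger parameters, so the regions to be
compared are half-lines in one direction. -/
lemma lt_of_loglik_pos {θ₀ θ x : ℝ} (hθ₀ : θ₀ ∈ F.Θ) (hθ : θ ∈ F.Θ) (hx : F.mean θ₀ < x)
    (h : 0 < (θ - θ₀) * x - (F.b θ - F.b θ₀)) : θ₀ < θ := by
  by_contra! hle
  nlinarith [F.mean_mul_sub_le hθ₀ hθ]

lemma gt_of_loglik_pos {θ₀ θ x : ℝ} (hθ₀ : θ₀ ∈ F.Θ) (hθ : θ ∈ F.Θ) (hx : x < F.mean θ₀)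
    (h : 0 < (θ - θ₀) * x - (F.b θ - F.b θ₀)) : θ < θ₀ := by
  by_contra! hle
  nlinarith [F.mean_mul_sub_le hθ₀ hθ]

end ExpFamily

/-! ### The threshold: inversion of `ψ` and first-order growth. -/

lemma psiInv_spec {z : ℝ} (hz : 1 ≤ z) :
    1 ≤ psiInv z ∧ psiInv z - Real.log (psiInv z) = z := by
  have hex : ∃ u ∈ Ici (1 : ℝ), psi u = z := by
    have hc : ContinuousOn psi (Icc 1 (4 * z)) :=
      continuousOn_id.sub (Real.continuousOn_log.mono fun x hx =>
        (show x ≠ 0 by have := hx.1; positivity))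
    -- This makes `4 z` an upper bracket: `ψ (4 z) ≥ 2 z ≥ z`.
    have hl : Real.log (4 * z) ≤ 2 * z := by
      have h1 := Real.log_le_sub_one_of_pos (show (0 : ℝ) < 4 * z / 4 by linarith)
      have h4 : Real.log 4 ≤ 2 := by
        rw [show (4 : ℝ) = 2 ^ 2 by norm_num, Real.log_pow]
        have := Real.log_two_lt_d9
        norm_num
        linarith
      rw [Real.log_div (by linarith) (by norm_num)] at h1
      linarith
    obtain ⟨u, hu, h⟩ := intermediate_value_Icc (show (1 : ℝ) ≤ 4 * z by linarith) hc
      (show z ∈ Icc (psi 1) (psi (4 * z)) from ⟨by simpa [psi] using hz, by rw [psi]; linarith⟩)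
    exact ⟨u, hu.1, h⟩
  exact ⟨Function.invFunOn_mem hex, Function.invFunOn_eq hex⟩

lemma le_psiInv {z : ℝ} (hz : 1 ≤ z) : z ≤ psiInv z := by
  obtain ⟨h1, h2⟩ := psiInv_spec hz
  linarith [Real.log_nonneg h1]

lemma log_three_halves_pos : 0 < Real.log (3 / 2) := Real.log_pos (by norm_num)

lemma one_le_one_div_log_three_halves : 1 ≤ 1 / Real.log (3 / 2) := by
  rw [le_div_iff₀ log_three_halves_pos]
  linarith [Real.log_le_sub_one_of_pos (show (0 : ℝ) < 3 / 2 by norm_num)]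

/-- The threshold `ψ̃_{3/2}` is the value at some `z ∈ (1, 3/2]` of `z (x - log log z)`. -/
lemma exists_psiTilde_eq (x : ℝ) :
    ∃ z ∈ Ioc (1 : ℝ) (3 / 2), psiTilde (3 / 2) x = z * (x - Real.log (Real.log z)) := by
  by_cases h : psiInv (1 / Real.log (3 / 2)) ≤ x
  · have h0 := le_psiInv one_le_one_div_log_three_halves
    have h1 := one_le_one_div_log_three_halves
    obtain ⟨hu, hu'⟩ := psiInv_spec (h1.trans (h0.trans h))
    have hxu := le_psiInv (h1.trans (h0.trans h))
    have hpos : 0 < psiInv x := by linarith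
    -- For this `z`, `log (log z) = -log (psiInv x)`, and `x + log (psiInv x) = psiInv x`. The case
    -- condition is what gives `z ≤ 3 / 2`.
    refine ⟨Real.exp (1 / psiInv x), ⟨Real.one_lt_exp_iff.2 (by positivity), ?_⟩, ?_⟩
    · rw [← Real.le_log_iff_exp_le (by norm_num)]
      exact (one_div_le hpos log_three_halves_pos).2 (h0.trans (h.trans hxu))
    · rw [psiTilde, if_pos h, Real.log_exp, one_div, Real.log_inv]
      congr 1
      linarith
  · exact ⟨3 / 2, ⟨by norm_num, le_rfl⟩, by rw [psiTilde, if_neg h]⟩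

lemma tendsto_psiInv_atTop : Tendsto psiInv atTop atTop :=
  tendsto_atTop_mono' _ (by filter_upwards [eventually_ge_atTop 1] with x hx using le_psiInv hx)
    tendsto_id

lemma tendsto_log_div_atTop : Tendsto (fun x : ℝ => Real.log x / x) atTop (𝓝 0) := by
  simpa using Real.isLittleO_log_id_atTop.tendsto_div_nhds_zero

lemma tendsto_psiInv_div : Tendsto (fun x => psiInv x / x) atTop (𝓝 1) := by
  have h : Tendsto (fun x => (1 - Real.log (psiInv x) / psiInv x)⁻¹) atTop (𝓝 (1 - 0)⁻¹) :=
    ((tendsto_log_div_atTop.comp tendsto_psiInv_atTop).const_sub 1).inv₀ (by norm_num)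
  rw [sub_zero, inv_one] at h
  refine h.congr' ?_
  filter_upwards [eventually_ge_atTop 1] with x hx
  obtain ⟨h1, h2⟩ := psiInv_spec hx
  have : psiInv x ≠ 0 := by positivity
  rw [one_sub_div this, inv_div, h2]

lemma tendsto_psiTilde_div : Tendsto (fun x => psiTilde (3 / 2) x / x) atTop (𝓝 1) := by
  have h : Tendsto (fun x => Real.exp (1 / psiInv x) * (psiInv x / x)) atTop
      (𝓝 (Real.exp 0 * 1)) := by
    refine Tendsto.mul ((Real.continuous_exp.tendsto 0).comp ?_) tendsto_psiInv_div
    simpa only [one_div] using! tendsto_psiInv_atTop.inv_tendsto_atTop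
  rw [Real.exp_zero, one_mul] at h
  refine h.congr' ?_
  filter_upwards [eventually_ge_atTop (psiInv (1 / Real.log (3 / 2)))] with x hx
  rw [psiTilde, if_pos hx, mul_div_assoc]

lemma tendsto_calT_div : Tendsto (fun x => calT x / x) atTop (𝓝 1) := by
  set a := Real.log (2 * zetaTwo)
  have hy : Tendsto (fun x : ℝ => (x + a) / 2) atTop atTop :=
    (tendsto_atTop_add_const_right _ a tendsto_id).atTop_div_const (by norm_num)
  have h1 : Tendsto (fun x : ℝ => 1 + a / x) atTop (𝓝 (1 + 0)) :=
    (tendsto_const_nhds.div_atTop tendsto_id).const_add 1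
  have h := (tendsto_psiTilde_div.comp hy).mul h1
  rw [add_zero, one_mul] at h
  refine h.congr' ?_
  filter_upwards [eventually_gt_atTop 0, eventually_gt_atTop (-a)] with x hx hxa
  have : x + a ≠ 0 := by linarith
  simp only [Function.comp_apply, calT]
  field_simp
  rfl

lemma summable_zetaTwo : Summable fun n : ℕ => 1 / ((n : ℝ) + 1) ^ 2 := by
  have h := (summable_nat_add_iff 1).2 (Real.summable_one_div_nat_pow.2 one_lt_two)
  simpa using h

lemma one_le_zetaTwo : 1 ≤ zetaTwo := by
  have h := summable_zetaTwo.le_tsum 0 fun j _ => by positivity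
  simpa [zetaTwo] using h

/-- Along geometric slices of the number of samples, the threshold dominates the levels of a union
bound with weights proportional to `1 / (i + 1) ^ 2`. -/
lemma exists_slice_le_beta (δ : ℝ) : ∃ z : ℝ, 1 < z ∧ ∀ n i : ℕ, 1 ≤ n → z ^ i ≤ (n : ℝ) →
    z * (Real.log (1 / δ) + Real.log (2 * zetaTwo) + 2 * Real.log (i + 1)) ≤ beta n δ := by
  obtain ⟨z, ⟨hz1, hz2⟩, hz⟩ :=
    exists_psiTilde_eq ((Real.log (1 / δ) + Real.log (2 * zetaTwo)) / 2)
  refine ⟨z, hz1, fun n i hn hi => ?_⟩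
  have hL : 0 < Real.log z := Real.log_pos hz1
  have hL1 : Real.log z ≤ 1 := by linarith [Real.log_le_sub_one_of_pos (by linarith : 0 < z)]
  have hn1 : (1 : ℝ) ≤ n := by exact_mod_cast hn
  have hlogn : 0 ≤ Real.log n := Real.log_nonneg hn1
  have hi' : (i : ℝ) * Real.log z ≤ Real.log n := by
    rw [← Real.log_pow]
    exact Real.log_le_log (by positivity) hi
  -- From `i log z ≤ log n` and `log z ≤ 1`, `i + 1 ≤ (1 + log n) / log z`. Multiplied by `2 z ≤ 3`,
  -- the first logarithm gives the term `3 log (1 + log n)` of `β`; the `log (log z)` term is the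
  -- one already contained in `calT`.
  have key : Real.log (i + 1) ≤ Real.log (1 + Real.log n) - Real.log (Real.log z) := by
    rw [← Real.log_div (by positivity) hL.ne']
    refine Real.log_le_log (by positivity) ?_
    rw [le_div_iff₀ hL]
    nlinarith
  have h0 : 0 ≤ Real.log (1 + Real.log n) := Real.log_nonneg (by linarith)
  rw [beta, calT, hz]
  nlinarith [mul_nonneg (sub_nonneg.2 hz2) h0, mul_nonneg (by linarith : 0 ≤ z) (sub_nonneg.2 key)]

/-! ### Ville's inequality. -/

section Ville

variable {Ω : Type*} [MeasurableSpace Ω] {P : Measure Ω} [IsProbabilityMeasure P] {Z : ℕ → Ω → ℝ}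

lemma integrable_prod_range (hm : ∀ i, Measurable (Z i)) (hind : iIndepFun Z P)
    (hint : ∀ i, Integrable (Z i) P) (n : ℕ) :
    Integrable (∏ i ∈ Finset.range n, Z i) P := by
  induction n with
  | zero => exact integrable_const (1 : ℝ)
  | succ n ih =>
    rw [Finset.prod_range_succ]
    exact (hind.indepFun_finsetProd_of_notMem hm Finset.notMem_range_self).integrable_mul ih
      (hint n)

/-- The past product is pulled out of the conditional expectation, leaving an independent factor of
mean one. The shift to `n + 1` factors makes time `n` involve exactly `Z 0, …, Z n`. -/
lemma martingale_prod_range (hm : ∀ i, Measurable (Z i)) (hind : iIndepFun Z P)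
    (hint : ∀ i, Integrable (Z i) P) (hone : ∀ i, ∫ ω, Z i ω ∂P = 1) :
    Martingale (fun n => ∏ i ∈ Finset.range (n + 1), Z i)
      (Filtration.natural Z fun i => (hm i).stronglyMeasurable) P := by
  have hadapt : StronglyAdapted (Filtration.natural Z fun i => (hm i).stronglyMeasurable)
      (fun n => ∏ i ∈ Finset.range (n + 1), Z i) := fun n =>
    Finset.stronglyMeasurable_prod _ fun i hi =>
      (Filtration.stronglyAdapted_natural fun i => (hm i).stronglyMeasurable).stronglyMeasurable_le
        (Nat.lt_succ_iff.1 (Finset.mem_range.1 hi))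
  refine martingale_nat hadapt (fun n => integrable_prod_range hm hind hint _) fun n => ?_
  have hpull := condExp_mul_of_stronglyMeasurable_left (μ := P) (hadapt n)
    (g := Z (n + 1))
    (by rw [← Finset.prod_range_succ]; exact integrable_prod_range hm hind hint _) (hint _)
  have hcond := hind.condExp_natural_ae_eq_of_lt (fun i => (hm i).stronglyMeasurable)
    (Nat.lt_succ_self n)
  rw [← Finset.prod_range_succ] at hpull
  filter_upwards [hpull, hcond] with ω h1 h2
  rw [h1, Pi.mul_apply, h2, hone, mul_one]

/-- Ville's inequality for products of independent nonnegative variables with mean one. -/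
lemma measure_exists_le_prod_range_le (hm : ∀ i, Measurable (Z i)) (hind : iIndepFun Z P)
    (hint : ∀ i, Integrable (Z i) P) (hone : ∀ i, ∫ ω, Z i ω ∂P = 1)
    (hpos : ∀ i ω, 0 ≤ Z i ω) {a : ℝ} (ha : 0 < a) :
    P {ω | ∃ n : ℕ, a ≤ ∏ i ∈ Finset.range (n + 1), Z i ω} ≤ ENNReal.ofReal a⁻¹ := by
  have hmart := martingale_prod_range hm hind hint hone
  set f : ℕ → Ω → ℝ := fun n => ∏ i ∈ Finset.range (n + 1), Z i with hf
  have hfapp : ∀ n ω, f n ω = ∏ i ∈ Finset.range (n + 1), Z i ω := fun n ω => by simp [hf]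
  have hnonneg : 0 ≤ f := fun n ω => by
    rw [hfapp]
    exact Finset.prod_nonneg fun i _ => hpos i ω
  have hmean : ∀ n, ∫ ω, f n ω ∂P = 1 := by
    intro n
    rw [← setIntegral_univ, ← hmart.setIntegral_eq (Nat.zero_le n) MeasurableSet.univ, setIntegral_univ]
    simpa [hfapp] using hone 0
  have hfin : ∀ n, P {ω | ∃ k ≤ n, a ≤ f k ω} ≤ ENNReal.ofReal a⁻¹ := by
    intro n
    have h := maximal_ineq hmart.submartingale hnonneg (ε := a.toNNReal) n
    simp only [Real.coe_toNNReal a ha.le, Finset.le_sup'_iff, Finset.mem_range,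
      Nat.lt_succ_iff] at h
    have h1 : ENNReal.ofReal (∫ ω in {ω | ∃ k ≤ n, a ≤ f k ω}, f n ω ∂P) ≤ 1 := by
      rw [← ENNReal.ofReal_one, ← hmean n]
      exact ENNReal.ofReal_le_ofReal (setIntegral_le_integral (hmart.integrable n)
        (ae_of_all _ fun ω => hnonneg n ω))
    change ENNReal.ofReal a * _ ≤ _ at h
    rw [ENNReal.ofReal_inv_of_pos ha, ENNReal.le_inv_iff_mul_le, mul_comm]
    exact h.trans h1
  have hun : {ω | ∃ n : ℕ, a ≤ ∏ i ∈ Finset.range (n + 1), Z i ω} =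
      ⋃ n, {ω | ∃ k ≤ n, a ≤ f k ω} := by
    ext ω
    simp only [mem_ofPred_eq, mem_iUnion, ← hfapp]
    exact ⟨fun ⟨n, h⟩ => ⟨n, n, le_rfl, h⟩, fun ⟨_, k, _, h⟩ => ⟨k, h⟩⟩
  have hmono : Monotone fun n => {ω | ∃ k ≤ n, a ≤ f k ω} := fun m n hmn ω ⟨k, hk, h⟩ =>
    ⟨k, hk.trans hmn, h⟩
  -- Doob's bound does not depend on the horizon, so continuity from below removes it.
  rw [hun, hmono.measure_iUnion]
  exact iSup_le hfin

end Ville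

/-- The average of the first `n` observations. -/
noncomputable def runMean {Ω : Type*} (X : ℕ → Ω → ℝ) (n : ℕ) (ω : Ω) : ℝ :=
  (∑ i ∈ Finset.range n, X i ω) / n

lemma sampleMean_eq_runMean {Ω : Type*} (X : ℕ → Ω → ℝ) (n : ℕ) (ω : Ω) :
    sampleMean (fun i : Fin n => X i ω) = runMean X n ω := by
  rw [sampleMean, runMean, Finset.sum_range]

/-! ### Time-uniform deviation bounds and coverage. -/

section Deviation

variable {Ω : Type*} [MeasurableSpace Ω] {P : Measure Ω} {X c : ℕ → Ω → ℝ} {κ : Measure ℝ}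
  {cbar : ℝ} {F : ExpFamily} {θ₀ : ℝ}

/-- The log-likelihood ratio of `θ` against the true parameter exceeds `y` with probability at
most `exp (-y)`, uniformly in the number of samples. -/
lemma measure_exists_le_loglik_le (h : IsCostlySampling P X c (F.law θ₀) κ cbar) {θ : ℝ}
    (hθ : θ ∈ F.Θ) (y : ℝ) :
    P {ω | ∃ n : ℕ, 1 ≤ n ∧ y ≤ n * ((θ - θ₀) * runMean X n ω - (F.b θ - F.b θ₀))} ≤
      ENNReal.ofReal (Real.exp (-y)) := by
  have := h.isProbability
  set g : ℝ → ℝ := fun x => Real.exp ((θ - θ₀) * x - (F.b θ - F.b θ₀)) with hg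
  have hgm : Measurable g := by fun_prop
  have hint : ∀ i, Integrable (fun ω => g (X i ω)) P := fun i => by
    have hi := F.integrable_tilt (θ₀ := θ₀) hθ
    rw [← h.law_sample i] at hi
    exact hi.comp_measurable (h.measurable_sample i)
  have hone : ∀ i, ∫ ω, g (X i ω) ∂P = 1 := fun i => by
    rw [← integral_map (h.measurable_sample i).aemeasurable hgm.aestronglyMeasurable,
      h.law_sample i]
    exact F.integral_tilt hθ
  have hv := measure_exists_le_prod_range_le (P := P) (Z := fun i ω => g (X i ω))
    (fun i => hgm.comp (h.measurable_sample i)) (h.indep_sample.comp (fun _ => g) fun _ => hgm)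
    hint hone (fun i ω => (Real.exp_pos _).le) (Real.exp_pos y)
  rw [← Real.exp_neg] at hv
  refine (measure_mono ?_).trans hv
  rintro ω ⟨n, hn, hy⟩
  -- The product of `n` factors has index `n - 1`.
  refine ⟨n - 1, ?_⟩
  rw [Nat.sub_add_cancel hn, hg, ← Real.exp_sum, Real.exp_le_exp, Finset.sum_sub_distrib,
    ← Finset.mul_sum, Finset.sum_const, Finset.card_range, nsmul_eq_mul]
  refine hy.trans (le_of_eq ?_)
  have hn0 : (n : ℝ) ≠ 0 := by positivity
  rw [runMean]
  field_simp

/-- A peeling slice, for parameters whose rejection regions are nested. -/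
lemma measure_slice_le (h : IsCostlySampling P X c (F.law θ₀) κ cbar) {I : Set ℝ}
    (hI : I ⊆ F.Θ) {T v : ℝ} (hv : 0 ≤ v)
    (htot : ∀ s ∈ I, ∀ t ∈ I,
      {x | v < (s - θ₀) * x - (F.b s - F.b θ₀)} ⊆ {x | v < (t - θ₀) * x - (F.b t - F.b θ₀)} ∨
      {x | v < (t - θ₀) * x - (F.b t - F.b θ₀)} ⊆ {x | v < (s - θ₀) * x - (F.b s - F.b θ₀)}) :
    P {ω | ∃ n : ℕ, 1 ≤ n ∧ T ≤ n ∧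
        ∃ θ ∈ I, v < (θ - θ₀) * runMean X n ω - (F.b θ - F.b θ₀)} ≤
      ENNReal.ofReal (Real.exp (-(T * v))) := by
  set s : I → Set ℝ := fun θ => {x | v < ((θ : ℝ) - θ₀) * x - (F.b θ - F.b θ₀)} with hs
  -- Lindelöf: countably many parameters give the same union of open regions.
  obtain ⟨J, hJ, hJs⟩ := TopologicalSpace.isOpen_iUnion_countable s fun θ =>
    isOpen_lt continuous_const (by fun_prop)
  set E : I → Set Ω := fun θ => {ω | ∃ n : ℕ, 1 ≤ n ∧ T ≤ n ∧ runMean X n ω ∈ s θ}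
  have hsub : {ω | ∃ n : ℕ, 1 ≤ n ∧ T ≤ n ∧
      ∃ θ ∈ I, v < (θ - θ₀) * runMean X n ω - (F.b θ - F.b θ₀)} ⊆ ⋃ θ ∈ J, E θ := by
    rintro ω ⟨n, hn, hTn, θ, hθ, hlt⟩
    have hmem : runMean X n ω ∈ ⋃ i, s i := mem_iUnion.2 ⟨⟨θ, hθ⟩, hlt⟩
    rw [← hJs] at hmem
    simp only [mem_iUnion] at hmem ⊢
    obtain ⟨θ', hθ', hx⟩ := hmem
    exact ⟨θ', hθ', n, hn, hTn, hx⟩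
  refine (measure_mono hsub).trans ?_
  -- The nested events form a directed family, so the measure of the union is a supremum, not a sum.
  rw [measure_biUnion_eq_iSup hJ]
  · refine iSup₂_le fun θ _ => ?_
    refine (measure_mono ?_).trans (measure_exists_le_loglik_le h (hI θ.2) (T * v))
    rintro ω ⟨n, hn, hTn, hx⟩
    exact ⟨n, hn, mul_le_mul hTn (le_of_lt hx) hv (Nat.cast_nonneg n)⟩
  · intro a ha b hb
    rcases htot a a.2 b b.2 with hab | hab
    · exact ⟨b, hb, fun ω ⟨n, hn, hTn, hx⟩ => ⟨n, hn, hTn, hab hx⟩, subset_rfl⟩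
    · exact ⟨a, ha, subset_rfl, fun ω ⟨n, hn, hTn, hx⟩ => ⟨n, hn, hTn, hab hx⟩⟩

/-- For `θ > θ₀` the log-likelihood ratio increases in `x`, so each rejection region is an upper
half-line, and half-lines are nested. -/
lemma measure_slice_upper_le (hθ₀ : θ₀ ∈ F.Θ) (h : IsCostlySampling P X c (F.law θ₀) κ cbar)
    {T v : ℝ} (hv : 0 ≤ v) :
    P {ω | ∃ n : ℕ, 1 ≤ n ∧ T ≤ n ∧ F.mean θ₀ < runMean X n ω ∧
        (v : EReal) < F.dExt (runMean X n ω) (F.mean θ₀)} ≤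
      ENNReal.ofReal (Real.exp (-(T * v))) := by
  have hIoi : ∀ θ ∈ F.Θ ∩ Ioi θ₀, {x | v < (θ - θ₀) * x - (F.b θ - F.b θ₀)} =
      Ioi ((v + (F.b θ - F.b θ₀)) / (θ - θ₀)) := fun θ hθ => by
    ext x
    rw [mem_ofPred_eq, mem_Ioi, div_lt_iff₀ (sub_pos.2 hθ.2), lt_sub_iff_add_lt, mul_comm]
  refine (measure_mono ?_).trans
    (measure_slice_le h (I := F.Θ ∩ Ioi θ₀) inter_subset_left hv fun s hs t ht => ?_)
  · rintro ω ⟨n, hn, hTn, hx, hd⟩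
    obtain ⟨θ, hθ, hlt⟩ := F.exists_lt_of_lt_dExt hθ₀ hd
    exact ⟨n, hn, hTn, θ, ⟨hθ, F.lt_of_loglik_pos hθ₀ hθ hx (hv.trans_lt hlt)⟩, hlt⟩
  · rw [hIoi s hs, hIoi t ht, Ioi_subset_Ioi_iff, Ioi_subset_Ioi_iff]
    exact le_total _ _

lemma measure_slice_lower_le (hθ₀ : θ₀ ∈ F.Θ) (h : IsCostlySampling P X c (F.law θ₀) κ cbar)
    {T v : ℝ} (hv : 0 ≤ v) :
    P {ω | ∃ n : ℕ, 1 ≤ n ∧ T ≤ n ∧ runMean X n ω < F.mean θ₀ ∧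
        (v : EReal) < F.dExt (runMean X n ω) (F.mean θ₀)} ≤
      ENNReal.ofReal (Real.exp (-(T * v))) := by
  have hIio : ∀ θ ∈ F.Θ ∩ Iio θ₀, {x | v < (θ - θ₀) * x - (F.b θ - F.b θ₀)} =
      Iio ((v + (F.b θ - F.b θ₀)) / (θ - θ₀)) := fun θ hθ => by
    ext x
    rw [mem_ofPred_eq, mem_Iio, lt_div_iff_of_neg (sub_neg.2 hθ.2), lt_sub_iff_add_lt, mul_comm]
  refine (measure_mono ?_).trans
    (measure_slice_le h (I := F.Θ ∩ Iio θ₀) inter_subset_left hv fun s hs t ht => ?_)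
  · rintro ω ⟨n, hn, hTn, hx, hd⟩
    obtain ⟨θ, hθ, hlt⟩ := F.exists_lt_of_lt_dExt hθ₀ hd
    exact ⟨n, hn, hTn, θ, ⟨hθ, F.gt_of_loglik_pos hθ₀ hθ hx (hv.trans_lt hlt)⟩, hlt⟩
  · rw [hIio s hs, hIio t ht, Iio_subset_Iio_iff, Iio_subset_Iio_iff]
    exact le_total _ _

/-- The union bound over slices, on the side of the mean selected by `Q`. -/
lemma measure_exists_beta_lt_le {δ : ℝ} (hδ : δ ∈ Ioo (0 : ℝ) 1) (Q : ℝ → Prop)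
    (hQ : ∀ T v : ℝ, 0 ≤ v →
      P {ω | ∃ n : ℕ, 1 ≤ n ∧ T ≤ n ∧ Q (runMean X n ω) ∧
        (v : EReal) < F.dExt (runMean X n ω) (F.mean θ₀)} ≤
      ENNReal.ofReal (Real.exp (-(T * v)))) :
    P {ω | ∃ n : ℕ, 1 ≤ n ∧ Q (runMean X n ω) ∧
        ((beta n δ : ℝ) : EReal) < (n : EReal) * F.dExt (runMean X n ω) (F.mean θ₀)} ≤
      ENNReal.ofReal (δ / 2) := by
  obtain ⟨z, hz, hbeta⟩ := exists_slice_le_beta δ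
  have hζ := one_le_zetaTwo
  have hz0 : 0 < z := by linarith
  set y : ℕ → ℝ := fun i =>
    Real.log (1 / δ) + Real.log (2 * zetaTwo) + 2 * Real.log (i + 1) with hy
  have hy0 : ∀ i, 0 ≤ y i := fun i => by
    have h1 : 0 ≤ Real.log (1 / δ) :=
      Real.log_nonneg (by rw [le_div_iff₀ hδ.1]; linarith [hδ.2])
    have h2 : 0 ≤ Real.log (2 * zetaTwo) := Real.log_nonneg (by linarith)
    have h3 : 0 ≤ Real.log ((i : ℝ) + 1) := Real.log_nonneg (by linarith [Nat.cast_nonneg (α := ℝ) i])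
    simp only [hy]
    linarith
  -- These slice errors sum to `δ / 2`, since the weights `1 / (i + 1) ^ 2` sum to `zetaTwo`.
  have hexp : ∀ i, Real.exp (-y i) = δ / (2 * zetaTwo) * (1 / ((i : ℝ) + 1) ^ 2) := fun i => by
    have hi : (0 : ℝ) < (i : ℝ) + 1 := by positivity
    have : y i = Real.log (1 / δ * (2 * zetaTwo) * ((i : ℝ) + 1) ^ 2) := by
      have := hδ.1
      rw [Real.log_mul (by positivity) (by positivity), Real.log_mul (by positivity) (by positivity),
        Real.log_pow]
      simp [hy]
    rw [this, Real.exp_neg, Real.exp_log (by have := hδ.1; positivity)]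
    field_simp
  set S : ℕ → Set Ω := fun i => {ω | ∃ n : ℕ, 1 ≤ n ∧ z ^ i ≤ n ∧ Q (runMean X n ω) ∧
    ((y i / z ^ i : ℝ) : EReal) < F.dExt (runMean X n ω) (F.mean θ₀)}
  have hsub : {ω | ∃ n : ℕ, 1 ≤ n ∧ Q (runMean X n ω) ∧
      ((beta n δ : ℝ) : EReal) < (n : EReal) * F.dExt (runMean X n ω) (F.mean θ₀)} ⊆
      ⋃ i, S i := by
    rintro ω ⟨n, hn, hQn, hlt⟩
    obtain ⟨i, hi, hi'⟩ := exists_nat_pow_near (show (1 : ℝ) ≤ n by exact_mod_cast hn) hz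
    refine mem_iUnion.2 ⟨i, n, hn, hi, hQn, ?_⟩
    by_contra! hle
    refine absurd hlt (not_lt.2 ?_)
    calc (n : EReal) * F.dExt (runMean X n ω) (F.mean θ₀)
        ≤ (n : EReal) * ((y i / z ^ i : ℝ) : EReal) :=
          mul_le_mul_of_nonneg_left hle (by exact_mod_cast Nat.zero_le n)
      _ = ((n * (y i / z ^ i) : ℝ) : EReal) := by rw [EReal.coe_mul]; rfl
      _ ≤ ((beta n δ : ℝ) : EReal) := by
          refine EReal.coe_le_coe_iff.2 (le_trans ?_ (hbeta n i hn hi))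
          -- Replacing `n` by the lower end of its slice loses at most the factor `z`, which `β`
          -- includes.
          calc n * (y i / z ^ i) ≤ z ^ (i + 1) * (y i / z ^ i) :=
                mul_le_mul_of_nonneg_right hi'.le (div_nonneg (hy0 i) (by positivity))
            _ = z * y i := by rw [pow_succ]; field_simp
  calc _ ≤ P (⋃ i, S i) := measure_mono hsub
    _ ≤ ∑' i, P (S i) := measure_iUnion_le _
    _ ≤ ∑' i : ℕ, ENNReal.ofReal (δ / (2 * zetaTwo) * (1 / ((i : ℝ) + 1) ^ 2)) := by
        refine ENNReal.tsum_le_tsum fun i => ?_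
        refine (hQ _ _ (div_nonneg (hy0 i) (by positivity))).trans (le_of_eq ?_)
        rw [← hexp i, mul_div_cancel₀ _ (by positivity : z ^ i ≠ 0)]
    _ = ENNReal.ofReal (δ / 2) := by
        have hδ0 := hδ.1
        rw [← ENNReal.ofReal_tsum_of_nonneg (fun i => by positivity)
          (summable_zetaTwo.mul_left _), tsum_mul_left]
        congr 1
        change δ / (2 * zetaTwo) * zetaTwo = δ / 2
        field_simp

/-- The reported interval always contains the sample mean, so only the end point on the side of the
true mean can fail. -/
lemma piHat_covers_of_not_beta_lt {θ : ℝ} (hθ : θ ∈ F.Θ) {n : ℕ} (x : Fin n → ℝ) (δ : ℝ)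
    (hx : 1 ≤ n → sampleMean x ≠ F.mean θ →
      (n : EReal) * F.dExt (sampleMean x) (F.mean θ) ≤ ((beta n δ : ℝ) : EReal)) :
    (piHat F).lower n x δ ≤ ((F.mean θ : ℝ) : EReal) ∧
      ((F.mean θ : ℝ) : EReal) ≤ (piHat F).upper n x δ := by
  have hO := F.mean_mem_O hθ
  rcases Nat.eq_zero_or_pos n with hn | hn
  · simp only [piHat, if_pos hn]
    exact ⟨sInf_le (mem_image_of_mem _ hO), le_sSup (mem_image_of_mem _ hO)⟩
  · simp only [piHat, if_neg hn.ne']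
    constructor
    · rcases le_or_gt (sampleMean x) (F.mean θ) with hle | hlt
      · exact (sInf_le (mem_insert _ _)).trans (EReal.coe_le_coe_iff.2 hle)
      · exact sInf_le (mem_insert_of_mem _ (mem_image_of_mem _ ⟨hO, hlt, hx hn hlt.ne'⟩))
    · rcases le_or_gt (F.mean θ) (sampleMean x) with hle | hlt
      · exact (EReal.coe_le_coe_iff.2 hle).trans (le_sSup (mem_insert _ _))
      · exact le_sSup (mem_insert_of_mem _ (mem_image_of_mem _ ⟨hO, hlt, hx hn hlt.ne⟩))

lemma piHat_coverage (hθ₀ : θ₀ ∈ F.Θ) (h : IsCostlySampling P X c (F.law θ₀) κ cbar) (B : ℝ)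
    {δ : ℝ} (hδ : δ ∈ Ioo (0 : ℝ) 1) :
    ENNReal.ofReal (1 - δ) ≤
      P {ω | lowerAt (piHat F) X c B δ ω ≤ ((F.mean θ₀ : ℝ) : EReal) ∧
        ((F.mean θ₀ : ℝ) : EReal) ≤ upperAt (piHat F) X c B δ ω} := by
  have := h.isProbability
  have hup := measure_exists_beta_lt_le (P := P) (X := X) hδ (fun x => F.mean θ₀ < x) fun T v hv =>
    measure_slice_upper_le hθ₀ h hv
  have hlo := measure_exists_beta_lt_le (P := P) (X := X) hδ (fun x => x < F.mean θ₀) fun T v hv =>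
    measure_slice_lower_le hθ₀ h hv
  set A := {ω | lowerAt (piHat F) X c B δ ω ≤ ((F.mean θ₀ : ℝ) : EReal) ∧
    ((F.mean θ₀ : ℝ) : EReal) ≤ upperAt (piHat F) X c B δ ω}
  set U := {ω | ∃ n : ℕ, 1 ≤ n ∧ F.mean θ₀ < runMean X n ω ∧
    ((beta n δ : ℝ) : EReal) < (n : EReal) * F.dExt (runMean X n ω) (F.mean θ₀)}
  set V := {ω | ∃ n : ℕ, 1 ≤ n ∧ runMean X n ω < F.mean θ₀ ∧
    ((beta n δ : ℝ) : EReal) < (n : EReal) * F.dExt (runMean X n ω) (F.mean θ₀)}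
  have hcover : (univ : Set Ω) ⊆ A ∪ (U ∪ V) := by
    intro ω _
    by_contra hω
    simp only [mem_union, not_or] at hω
    obtain ⟨hA, hU, hV⟩ := hω
    refine hA (piHat_covers_of_not_beta_lt hθ₀ _ δ fun hn hne => ?_)
    rw [sampleMean_eq_runMean] at hne ⊢
    by_contra! hlt
    rcases hne.lt_or_gt with hlt' | hlt'
    · exact hV ⟨_, hn, hlt', hlt⟩
    · exact hU ⟨_, hn, hlt', hlt⟩
  have hbound : (1 : ENNReal) ≤ P A + ENNReal.ofReal δ := by
    calc (1 : ENNReal) = P univ := measure_univ.symm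
      _ ≤ P (A ∪ (U ∪ V)) := measure_mono hcover
      _ ≤ P A + (P U + P V) := (measure_union_le _ _).trans (by gcongr; exact measure_union_le _ _)
      _ ≤ P A + (ENNReal.ofReal (δ / 2) + ENNReal.ofReal (δ / 2)) := by gcongr
      _ = P A + ENNReal.ofReal δ := by
        rw [← ENNReal.ofReal_add (by linarith [hδ.1]) (by linarith [hδ.1]), add_halves]
  rw [ENNReal.ofReal_sub _ hδ.1.le, ENNReal.ofReal_one]
  exact tsub_le_iff_right.2 hbound

end Deviation

/-! ### Level sets of the divergence and their continuity. -/

namespace ExpFamily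

variable (F : ExpFamily)

/-- The supremum of the means `q > m` with `d(m, q) ≤ v`, and `m` if there is none. -/
noncomputable def upperLevel (m : ℝ) (v : EReal) : EReal :=
  sSup (insert (m : EReal) ((fun q : ℝ => (q : EReal)) ''
    {q : ℝ | q ∈ F.O ∧ m < q ∧ ((F.d m q : ℝ) : EReal) ≤ v}))

/-- The infimum of the means `q < m` with `d(m, q) ≤ v`, and `m` if there is none. -/
noncomputable def lowerLevel (m : ℝ) (v : EReal) : EReal :=
  sInf (insert (m : EReal) ((fun q : ℝ => (q : EReal)) ''
    {q : ℝ | q ∈ F.O ∧ q < m ∧ ((F.d m q : ℝ) : EReal) ≤ v}))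

lemma le_upperLevel (m : ℝ) (v : EReal) : (m : EReal) ≤ F.upperLevel m v :=
  le_sSup (mem_insert _ _)

lemma lowerLevel_le (m : ℝ) (v : EReal) : F.lowerLevel m v ≤ (m : EReal) :=
  sInf_le (mem_insert _ _)

variable {F}

/-- Strict monotonicity of `d(m, ·)` provides strict inequalities on both sides of the level, and
these survive small changes of centre and height. An infinite height is allowed. -/
lemma tendsto_upperLevel {α : Type*} {l : Filter α} {x : α → ℝ} {r : α → EReal} {m : ℝ}
    {v : EReal} (hm : m ∈ F.O) (hx : Tendsto x l (𝓝 m)) (hr : Tendsto r l (𝓝 v)) :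
    Tendsto (fun a => F.upperLevel (x a) (r a)) l (𝓝 (F.upperLevel m v)) := by
  have hd : ∀ q, Tendsto (fun a => ((F.d (x a) q : ℝ) : EReal)) l (𝓝 ((F.d m q : ℝ) : EReal)) :=
    fun q => (continuous_coe_real_ereal.tendsto _).comp ((F.continuousAt_d_left hm q).tendsto.comp hx)
  rw [tendsto_order]
  constructor
  · intro a ha
    obtain ⟨b, hb, hab⟩ := lt_sSup_iff.1 ha
    rcases hb with rfl | ⟨q, ⟨hqO, hmq, hqv⟩, rfl⟩
    · filter_upwards [((continuous_coe_real_ereal.tendsto m).comp hx).eventually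
        (lt_mem_nhds hab)] with i hi
      exact hi.trans_le (F.le_upperLevel _ _)
    -- Moving from `q` slightly back to `q'` turns `d(m, q) ≤ v` into `d(m, q') < v`.
    · obtain ⟨q', h1, h2⟩ := EReal.lt_iff_exists_real_btwn.1
        (max_lt hab (EReal.coe_lt_coe_iff.2 hmq))
      have hmq' : m < q' := EReal.coe_lt_coe_iff.1 ((le_max_right _ _).trans_lt h1)
      have hq'q : q' < q := EReal.coe_lt_coe_iff.1 h2
      have hq'O : q' ∈ F.O := F.ordConnected_O.out hm hqO ⟨hmq'.le, hq'q.le⟩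
      have hlt : ((F.d m q' : ℝ) : EReal) < v :=
        (EReal.coe_lt_coe_iff.2 (F.d_lt_d_of_lt hm hq'O hqO hmq'.le hq'q)).trans_le hqv
      filter_upwards [(hd q').eventually_lt hr hlt, hx.eventually (gt_mem_nhds hmq')] with i hi hi'
      exact ((le_max_left _ _).trans_lt h1).trans_le
        (le_sSup (mem_insert_of_mem _ (mem_image_of_mem _ ⟨hq'O, hi', hi.le⟩)))
  · intro a ha
    obtain ⟨q, h1, h2⟩ := EReal.lt_iff_exists_real_btwn.1 ha
    have hmq : m < q := EReal.coe_lt_coe_iff.1 ((F.le_upperLevel m v).trans_lt h1)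
    -- The comparison is conditional because `q` may lie beyond the end of `O`; then no mean exceeds
    -- `q` at all.
    have hev : ∀ᶠ i in l, x i ∈ F.O ∧ x i < q ∧ (q ∈ F.O → r i < ((F.d (x i) q : ℝ) : EReal)) := by
      refine (hx.eventually (F.isOpen_O.mem_nhds hm)).and
        ((hx.eventually (gt_mem_nhds hmq)).and ?_)
      by_cases hq : q ∈ F.O
      · have hlt : v < ((F.d m q : ℝ) : EReal) := by
          by_contra! hle
          exact absurd h1 (not_lt.2 (le_sSup (mem_insert_of_mem _
            (mem_image_of_mem _ ⟨hq, hmq, hle⟩))))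
        exact (hr.eventually_lt (hd q) hlt).mono fun i hi _ => hi
      · exact Eventually.of_forall fun i h => absurd h hq
    filter_upwards [hev] with i ⟨hxO, hxq, hri⟩
    refine lt_of_le_of_lt (sSup_le ?_) h2
    rintro _ (rfl | ⟨q', ⟨hq'O, hxq', hle⟩, rfl⟩)
    · exact EReal.coe_le_coe_iff.2 hxq.le
    · refine EReal.coe_le_coe_iff.2 ?_
      by_contra! hlt
      have hqO : q ∈ F.O := F.ordConnected_O.out hxO hq'O ⟨hxq.le, hlt.le⟩
      exact absurd (hri hqO) (not_lt.2 (le_trans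
        (EReal.coe_le_coe_iff.2 (F.d_lt_d_of_lt hxO hqO hq'O hxq.le hlt).le) hle))

lemma tendsto_lowerLevel {α : Type*} {l : Filter α} {x : α → ℝ} {r : α → EReal} {m : ℝ}
    {v : EReal} (hm : m ∈ F.O) (hx : Tendsto x l (𝓝 m)) (hr : Tendsto r l (𝓝 v)) :
    Tendsto (fun a => F.lowerLevel (x a) (r a)) l (𝓝 (F.lowerLevel m v)) := by
  have hd : ∀ q, Tendsto (fun a => ((F.d (x a) q : ℝ) : EReal)) l (𝓝 ((F.d m q : ℝ) : EReal)) :=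
    fun q => (continuous_coe_real_ereal.tendsto _).comp ((F.continuousAt_d_left hm q).tendsto.comp hx)
  rw [tendsto_order]
  constructor
  · intro a ha
    obtain ⟨q, h2, h1⟩ := EReal.lt_iff_exists_real_btwn.1 ha
    have hmq : q < m := EReal.coe_lt_coe_iff.1 (h1.trans_le (F.lowerLevel_le m v))
    have hev : ∀ᶠ i in l, x i ∈ F.O ∧ q < x i ∧ (q ∈ F.O → r i < ((F.d (x i) q : ℝ) : EReal)) := by
      refine (hx.eventually (F.isOpen_O.mem_nhds hm)).and
        ((hx.eventually (lt_mem_nhds hmq)).and ?_)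
      by_cases hq : q ∈ F.O
      · have hlt : v < ((F.d m q : ℝ) : EReal) := by
          by_contra! hle
          exact absurd h1 (not_lt.2 (sInf_le (mem_insert_of_mem _
            (mem_image_of_mem _ ⟨hq, hmq, hle⟩))))
        exact (hr.eventually_lt (hd q) hlt).mono fun i hi _ => hi
      · exact Eventually.of_forall fun i h => absurd h hq
    filter_upwards [hev] with i ⟨hxO, hxq, hri⟩
    refine lt_of_lt_of_le h2 (le_sInf ?_)
    rintro _ (rfl | ⟨q', ⟨hq'O, hxq', hle⟩, rfl⟩)
    · exact EReal.coe_le_coe_iff.2 hxq.le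
    · refine EReal.coe_le_coe_iff.2 ?_
      by_contra! hlt
      have hqO : q ∈ F.O := F.ordConnected_O.out hq'O hxO ⟨hlt.le, hxq.le⟩
      exact absurd (hri hqO) (not_lt.2 (le_trans
        (EReal.coe_le_coe_iff.2 (F.d_lt_d_of_gt hxO hqO hq'O hxq.le hlt).le) hle))
  · intro a ha
    obtain ⟨b, hb, hab⟩ := sInf_lt_iff.1 ha
    rcases hb with rfl | ⟨q, ⟨hqO, hmq, hqv⟩, rfl⟩
    · filter_upwards [((continuous_coe_real_ereal.tendsto m).comp hx).eventually
        (gt_mem_nhds hab)] with i hi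
      exact (F.lowerLevel_le _ _).trans_lt hi
    · obtain ⟨q', h2, h1⟩ := EReal.lt_iff_exists_real_btwn.1
        (lt_min hab (EReal.coe_lt_coe_iff.2 hmq))
      have hmq' : q' < m := EReal.coe_lt_coe_iff.1 (h1.trans_le (min_le_right _ _))
      have hq'q : q < q' := EReal.coe_lt_coe_iff.1 h2
      have hq'O : q' ∈ F.O := F.ordConnected_O.out hqO hm ⟨hq'q.le, hmq'.le⟩
      have hlt : ((F.d m q' : ℝ) : EReal) < v :=
        (EReal.coe_lt_coe_iff.2 (F.d_lt_d_of_gt hm hq'O hqO hmq'.le hq'q)).trans_le hqv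
      filter_upwards [(hd q').eventually_lt hr hlt, hx.eventually (lt_mem_nhds hmq')] with i hi hi'
      exact lt_of_le_of_lt (sInf_le (mem_insert_of_mem _ (mem_image_of_mem _ ⟨hq'O, hi', hi.le⟩)))
        (h1.trans_le (min_le_left _ _))

/-- The case `q = m`, `v = 0` is included: it gives the collapse of the interval under complete
learning. -/
lemma upperLevel_eq_of_d_eq {m q v : ℝ} (hm : m ∈ F.O) (hq : q ∈ F.O) (hmq : m ≤ q)
    (hd : F.d m q = v) : F.upperLevel m v = q := by
  refine le_antisymm (sSup_le ?_) ?_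
  · rintro _ (rfl | ⟨r, ⟨hr, hmr, hle⟩, rfl⟩)
    · exact EReal.coe_le_coe_iff.2 hmq
    · refine EReal.coe_le_coe_iff.2 ?_
      by_contra! hlt
      have := F.d_lt_d_of_lt hm hq hr hmq hlt
      have hle' := EReal.coe_le_coe_iff.1 hle
      linarith
  · rcases hmq.eq_or_lt with rfl | hlt
    · exact F.le_upperLevel _ _
    · exact le_sSup (mem_insert_of_mem _ (mem_image_of_mem _
        ⟨hq, hlt, EReal.coe_le_coe_iff.2 hd.le⟩))

lemma lowerLevel_eq_of_d_eq {m q v : ℝ} (hm : m ∈ F.O) (hq : q ∈ F.O) (hmq : q ≤ m)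
    (hd : F.d m q = v) : F.lowerLevel m v = q := by
  refine le_antisymm ?_ (le_sInf ?_)
  · rcases hmq.eq_or_lt with rfl | hlt
    · exact F.lowerLevel_le _ _
    · exact sInf_le (mem_insert_of_mem _ (mem_image_of_mem _
        ⟨hq, hlt, EReal.coe_le_coe_iff.2 hd.le⟩))
  · rintro _ (rfl | ⟨r, ⟨hr, hmr, hle⟩, rfl⟩)
    · exact EReal.coe_le_coe_iff.2 hmq
    · refine EReal.coe_le_coe_iff.2 ?_
      by_contra! hlt
      have := F.d_lt_d_of_gt hm hq hr hmq hlt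
      have hle' := EReal.coe_le_coe_iff.1 hle
      linarith

/-- If `d(m, ·)` reaches the level `v` on both sides, the level is attained. -/
lemma exists_solvesSystem {m v : ℝ} (hm : m ∈ F.O) (hv : 0 < v) (h : F.Reaches m v) :
    ∃ qL qR, F.SolvesSystem m v qL qR := by
  obtain ⟨⟨a, haO, ham, hav⟩, ⟨b, hbO, hmb, hbv⟩⟩ := h
  obtain ⟨qL, hL, hLv⟩ := intermediate_value_Icc' ham.le
    ((F.continuousOn_d_right m).mono (F.ordConnected_O.out haO hm))
    (show v ∈ Icc (F.d m m) (F.d m a) from ⟨by rw [F.d_self]; exact hv.le, hav⟩)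
  obtain ⟨qR, hR, hRv⟩ := intermediate_value_Icc hmb.le
    ((F.continuousOn_d_right m).mono (F.ordConnected_O.out hm hbO))
    (show v ∈ Icc (F.d m m) (F.d m b) from ⟨by rw [F.d_self]; exact hv.le, hbv⟩)
  refine ⟨qL, qR, F.ordConnected_O.out haO hm hL, F.ordConnected_O.out hm hbO hR,
    hL.2.lt_of_ne ?_, hR.1.lt_of_ne ?_, hRv, hLv⟩
  · rintro rfl
    rw [F.d_self] at hLv
    exact hv.ne hLv
  · rintro rfl
    rw [F.d_self] at hRv
    exact hv.ne hRv

lemma SolvesSystem.unique {m v qL qR qL' qR' : ℝ} (hm : m ∈ F.O)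
    (h : F.SolvesSystem m v qL qR) (h' : F.SolvesSystem m v qL' qR') : qL' = qL ∧ qR' = qR := by
  obtain ⟨hL, hR, hLm, hmR, hRv, hLv⟩ := h
  obtain ⟨hL', hR', hLm', hmR', hRv', hLv'⟩ := h'
  constructor
  · rcases lt_trichotomy qL' qL with hlt | heq | hlt
    · linarith [F.d_lt_d_of_gt hm hL hL' hLm.le hlt]
    · exact heq
    · linarith [F.d_lt_d_of_gt hm hL' hL hLm'.le hlt]
  · rcases lt_trichotomy qR' qR with hlt | heq | hlt
    · linarith [F.d_lt_d_of_lt hm hR' hR hmR'.le hlt]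
    · exact heq
    · linarith [F.d_lt_d_of_lt hm hR hR' hmR.le hlt]

end ExpFamily

/-! ### Asymptotics of the number of samples and of the sample mean. -/

/-- Elementary renewal bounds: if the average cost is within `ε` of `cbar` from `N` samples on, then
the number of affordable samples is close to `B / cbar`. -/
lemma tau_bounds {Ω : Type*} {c : ℕ → Ω → ℝ} {ω : Ω} {cbar ε B : ℝ} {N : ℕ} (hε : 0 < ε)
    (hεc : ε < cbar) (hN : 1 ≤ N) (hc : ∀ n ≥ N, |runMean c n ω - cbar| < ε)
    (hB : (N + 1) * (cbar + ε) ≤ B) :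
    N ≤ tau c B ω ∧ B / (cbar + ε) - 1 ≤ tau c B ω ∧ tau c B ω ≤ B / (cbar - ε) := by
  have hsum : ∀ n ≥ N, n * (cbar - ε) ≤ ∑ i ∈ Finset.range n, c i ω ∧
      ∑ i ∈ Finset.range n, c i ω ≤ n * (cbar + ε) := by
    intro n hn
    have hn0 : (0 : ℝ) < n := by exact_mod_cast hN.trans hn
    have h := abs_lt.1 (hc n hn)
    have heq : ∑ i ∈ Finset.range n, c i ω = n * runMean c n ω := by
      rw [runMean, mul_div_cancel₀ _ hn0.ne']
    rw [heq]
    constructor <;> refine mul_le_mul_of_nonneg_left ?_ hn0.le <;> linarith [h.1, h.2]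
  have hpos : 0 < cbar + ε := by linarith
  have hpos' : 0 < cbar - ε := by linarith
  set S := {n : ℕ | 1 ≤ n ∧ ∑ i ∈ Finset.range n, c i ω ≤ B} with hS
  have hub : ∀ n ∈ S, N ≤ n → (n : ℝ) ≤ B / (cbar - ε) := fun n hn hNn => by
    rw [le_div_iff₀ hpos']
    exact (hsum n hNn).1.trans hn.2
  -- Needed because `sSup` of an unbounded set of naturals is `0`.
  have hbdd : BddAbove S := by
    refine ⟨max N ⌊B / (cbar - ε)⌋₊, fun n hn => ?_⟩
    rcases le_total n N with h | h
    · exact h.trans (le_max_left _ _)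
    · exact (Nat.le_floor (hub n hn h)).trans (le_max_right _ _)
  have hquot : (N : ℝ) + 1 ≤ B / (cbar + ε) := (le_div_iff₀ hpos).2 hB
  have hNk : N ≤ ⌊B / (cbar + ε)⌋₊ := Nat.le_floor (by linarith)
  have hkS : ⌊B / (cbar + ε)⌋₊ ∈ S := by
    refine ⟨hN.trans hNk, (hsum _ hNk).2.trans ?_⟩
    rw [← le_div_iff₀ hpos]
    exact Nat.floor_le (by linarith [Nat.cast_nonneg (α := ℝ) N])
  have hkτ : ⌊B / (cbar + ε)⌋₊ ≤ tau c B ω := le_csSup hbdd hkS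
  have hτS : tau c B ω ∈ S := Nat.sSup_mem ⟨_, hkS⟩ hbdd
  refine ⟨hNk.trans hkτ, ?_, hub _ hτS (hNk.trans hkτ)⟩
  have h1 := Nat.lt_floor_add_one (B / (cbar + ε))
  have h2 : (⌊B / (cbar + ε)⌋₊ : ℝ) ≤ tau c B ω := by exact_mod_cast hkτ
  linarith

/-- The renewal bounds depend on `ω` only through `N`, which is common to all of `s`. Half of `η`
pays for `ε`, half for the rounding error `1 / B`. -/
lemma tendstoUniformlyOn_tau {Ω : Type*} {c : ℕ → Ω → ℝ} {cbar : ℝ} (hcbar : 0 < cbar)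
    {s : Set Ω} (hc : TendstoUniformlyOn (runMean c) (fun _ => cbar) atTop s) :
    TendstoUniformlyOn (fun B ω => (tau c B ω : ℝ) / B) (fun _ => cbar⁻¹) atTop s := by
  rw [Metric.tendstoUniformlyOn_iff]
  intro η hη
  have hcont : ContinuousAt (fun e : ℝ => e⁻¹) cbar := continuousAt_inv₀ hcbar.ne'
  obtain ⟨ρ, hρ, hball⟩ := Metric.continuousAt_iff.1 hcont (η / 2) (by linarith)
  set ε := min (ρ / 2) (cbar / 2) with hε
  have hε0 : 0 < ε := by positivity
  have hερ : ε < ρ := (min_le_left _ _).trans_lt (by linarith)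
  have hεc : ε < cbar := (min_le_right _ _).trans_lt (by linarith)
  have hp := abs_lt.1 (hball (x := cbar + ε) (by simpa [Real.dist_eq, abs_of_pos hε0] using hερ))
  have hm := abs_lt.1 (hball (x := cbar - ε) (by simpa [Real.dist_eq, abs_of_pos hε0] using hερ))
  obtain ⟨N, hN⟩ := eventually_atTop.1 (Metric.tendstoUniformlyOn_iff.1 hc ε hε0)
  filter_upwards [eventually_ge_atTop (((max N 1 : ℕ) + 1) * (cbar + ε)),
    eventually_gt_atTop (2 / η), eventually_gt_atTop 0] with B hB hBη hB0 ω hω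
  obtain ⟨-, h1, h2⟩ := tau_bounds (ω := ω) (c := c) hε0 hεc (le_max_right N 1) (fun n hn => by
    have := hN n ((le_max_left _ _).trans hn) ω hω
    rwa [dist_comm, Real.dist_eq] at this) hB
  have hinv : 1 / B < η / 2 := by
    rw [div_lt_iff₀ hη] at hBη
    rw [div_lt_iff₀ hB0]
    linarith
  have h1' : (cbar + ε)⁻¹ - 1 / B ≤ tau c B ω / B := by
    rw [le_div_iff₀ hB0]
    have : ((cbar + ε)⁻¹ - 1 / B) * B = B / (cbar + ε) - 1 := by field_simp
    rwa [this]
  have h2' : tau c B ω / B ≤ (cbar - ε)⁻¹ := by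
    rw [div_le_iff₀ hB0, ← div_eq_inv_mul]
    exact h2
  rw [dist_comm, Real.dist_eq, abs_lt]
  constructor <;> linarith [hp.1, hm.2]

lemma tendstoUniformlyOn_runMean_tau {Ω : Type*} {X c : ℕ → Ω → ℝ} {cbar μ : ℝ} (hcbar : 0 < cbar)
    {s : Set Ω} (hc : TendstoUniformlyOn (runMean c) (fun _ => cbar) atTop s)
    (hX : TendstoUniformlyOn (runMean X) (fun _ => μ) atTop s) :
    TendstoUniformlyOn (fun B ω => runMean X (tau c B ω) ω) (fun _ => μ) atTop s := by
  rw [Metric.tendstoUniformlyOn_iff] at hX ⊢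
  intro η hη
  obtain ⟨N, hN⟩ := eventually_atTop.1
    ((Metric.tendstoUniformlyOn_iff.1 hc (cbar / 2) (by linarith)).and (hX η hη))
  filter_upwards [eventually_ge_atTop (((max N 1 : ℕ) + 1) * (cbar + cbar / 2))] with B hB ω hω
  obtain ⟨h1, -⟩ := tau_bounds (ω := ω) (c := c) (by linarith) (by linarith) (le_max_right N 1)
    (fun n hn => by
      have := (hN n ((le_max_left _ _).trans hn)).1 ω hω
      rwa [dist_comm, Real.dist_eq] at this) hB
  exact (hN _ ((le_max_left _ _).trans h1)).2 ω hω

section Sampling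

variable {Ω : Type*} [MeasurableSpace Ω] {P : Measure Ω} {X c : ℕ → Ω → ℝ} {ν κ : Measure ℝ}
  {cbar : ℝ}

lemma measurable_runMean {X : ℕ → Ω → ℝ} (hX : ∀ i, Measurable (X i)) (n : ℕ) :
    Measurable (runMean X n) := by
  unfold runMean
  fun_prop

lemma tendsto_runMean_ae (hX : ∀ i, Measurable (X i)) (hlaw : ∀ i, P.map (X i) = ν)
    (hind : iIndepFun X P) (hint : Integrable (fun x : ℝ => x) ν) :
    ∀ᵐ ω ∂P, Tendsto (fun n => runMean X n ω) atTop (𝓝 (∫ x, x ∂ν)) := by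
  have h := strong_law_ae_real (μ := P) X
    (by rw [← hlaw 0] at hint; exact hint.comp_measurable (hX 0))
    (fun i j hij => hind.indepFun hij)
    (fun i => ⟨(hX i).aemeasurable, (hX 0).aemeasurable, by rw [hlaw i, hlaw 0]⟩)
  have hmean : ∫ ω, X 0 ω ∂P = ∫ x, x ∂ν := by
    rw [← hlaw 0, integral_map (hX 0).aemeasurable (by fun_prop)]
  rwa [hmean] at h

lemma IsCostlySampling.cbar_pos (h : IsCostlySampling P X c ν κ cbar) : 0 < cbar := by
  have := h.isProbability
  have : IsProbabilityMeasure κ := by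
    rw [← h.law_cost 0]
    exact Measure.isProbabilityMeasure_map (h.measurable_cost 0).aemeasurable
  have hnn : 0 ≤ᵐ[κ] fun y : ℝ => y := h.cost_pos.mono fun y hy => le_of_lt hy
  rw [← h.mean_cost]
  refine lt_of_le_of_ne (integral_nonneg_of_ae hnn) fun h0 => ?_
  have hz := (integral_eq_zero_iff_of_nonneg_ae hnn h.integrable_cost).1 h0.symm
  obtain ⟨y, hy, hy'⟩ := (h.cost_pos.and hz).exists
  exact hy.ne' hy'

/-- Triples of a level, a number of samples and a sample average, as the level tends to `0` with
`n ~ C δ / cbar` and the average tending to `μ`. -/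
noncomputable def samplingFilter (C : ℝ → ℝ) (cbar μ : ℝ) : Filter (ℝ × ℕ × ℝ) :=
  comap (fun p => p.1) (𝓝[>] 0) ⊓ comap (fun p => (p.2.1 : ℝ) / C p.1) (𝓝 cbar⁻¹) ⊓
    comap (fun p => p.2.2) (𝓝 μ)

/-- Egorov's theorem, applied to samples and costs, leaves a small exceptional event off which the
triple lies in `E` for all small `δ`. Deterministic limits along `samplingFilter` thereby become
limits in probability. -/
lemma tendsto_measure_notMem_samplingFilter (h : IsCostlySampling P X c ν κ cbar)
    (hν : Integrable (fun x : ℝ => x) ν) {C : ℝ → ℝ} (hC : Tendsto C (𝓝[>] 0) atTop)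
    {E : Set (ℝ × ℕ × ℝ)} (hE : E ∈ samplingFilter C cbar (∫ x, x ∂ν)) :
    Tendsto (fun δ => P {ω | (δ, tau c (C δ) ω, runMean X (tau c (C δ) ω) ω) ∉ E}) (𝓝[>] 0)
      (𝓝 0) := by
  have := h.isProbability
  rw [ENNReal.tendsto_nhds_zero]
  intro η hη
  -- Truncation, as `η` may be infinite.
  have hη' : 0 < min η 1 := lt_min hη one_pos
  have hηtop : min η 1 ≠ ⊤ := ((min_le_right _ _).trans_lt ENNReal.one_lt_top).ne
  have hη2 : 0 < (min η 1).toReal / 2 := half_pos (ENNReal.toReal_pos hη'.ne' hηtop)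
  have hXae := tendsto_runMean_ae h.measurable_sample h.law_sample h.indep_sample hν
  have hcae := tendsto_runMean_ae h.measurable_cost h.law_cost h.indep_cost h.integrable_cost
  rw [h.mean_cost] at hcae
  obtain ⟨s, -, hs, hsX⟩ := tendstoUniformlyOn_of_ae_tendsto'
    (fun n => (measurable_runMean h.measurable_sample n).stronglyMeasurable)
    stronglyMeasurable_const hXae hη2
  obtain ⟨t, -, ht, htc⟩ := tendstoUniformlyOn_of_ae_tendsto'
    (fun n => (measurable_runMean h.measurable_cost n).stronglyMeasurable)
    stronglyMeasurable_const hcae hη2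
  have hX' := hsX.mono (show (s ∪ t)ᶜ ⊆ sᶜ from compl_subset_compl.2 subset_union_left)
  have hc' := htc.mono (show (s ∪ t)ᶜ ⊆ tᶜ from compl_subset_compl.2 subset_union_right)
  have hτ := tendstoUniformlyOn_tau h.cbar_pos hc'
  have hm := tendstoUniformlyOn_runMean_tau h.cbar_pos hc' hX'
  obtain ⟨E₁, hE₁, E₂, hE₂, hsub⟩ := mem_inf_iff_superset.1 hE
  obtain ⟨E₃, hE₃, E₄, hE₄, hsub'⟩ := mem_inf_iff_superset.1 hE₁
  obtain ⟨D, hD, hD'⟩ := mem_comap.1 hE₃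
  obtain ⟨V, hV, hV'⟩ := mem_comap.1 hE₄
  obtain ⟨W, hW, hW'⟩ := mem_comap.1 hE₂
  obtain ⟨r₁, hr₁, hr₁'⟩ := Metric.mem_nhds_iff.1 hV
  obtain ⟨r₂, hr₂, hr₂'⟩ := Metric.mem_nhds_iff.1 hW
  filter_upwards [hD, hC.eventually (Metric.tendstoUniformlyOn_iff.1 hτ r₁ hr₁),
    hC.eventually (Metric.tendstoUniformlyOn_iff.1 hm r₂ hr₂)] with δ hδ h1 h2
  have hbad : {ω | (δ, tau c (C δ) ω, runMean X (tau c (C δ) ω) ω) ∉ E} ⊆ s ∪ t := by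
    intro ω hω
    by_contra hst
    refine hω (hsub ⟨hsub' ⟨hD' hδ, hV' (hr₁' ?_)⟩, hW' (hr₂' ?_)⟩)
    · rw [Metric.mem_ball, dist_comm]
      exact h1 ω hst
    · rw [Metric.mem_ball, dist_comm]
      exact h2 ω hst
  calc _ ≤ P (s ∪ t) := measure_mono hbad
    _ ≤ P s + P t := measure_union_le _ _
    _ ≤ ENNReal.ofReal ((min η 1).toReal / 2) + ENNReal.ofReal ((min η 1).toReal / 2) := by gcongr
    _ = min η 1 := by
      rw [← ENNReal.ofReal_add hη2.le hη2.le, add_halves, ENNReal.ofReal_toReal hηtop]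
    _ ≤ η := min_le_left _ _

end Sampling

/-! ### Regular families reach every level. -/

namespace ExpFamily

variable {F : ExpFamily}

lemma lintegral_exp_mul {θ : ℝ} (hθ : θ ∈ F.Θ) :
    ∫⁻ x, ENNReal.ofReal (Real.exp (θ * x)) ∂F.ξ = ENNReal.ofReal (Real.exp (F.b θ)) := by
  rw [← mul_one (ENNReal.ofReal (Real.exp (F.b θ))), ← F.lintegral_density hθ,
    ← lintegral_const_mul _ (F.measurable_density θ)]
  refine lintegral_congr fun x => ?_
  rw [← ENNReal.ofReal_mul (Real.exp_pos _).le, ← Real.exp_add]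
  ring_nf

/-- If `b` is bounded along parameters that approach `s`, then `s` is a natural parameter. -/
lemma integrable_exp_of_bounded {l : Filter ℝ} [l.NeBot] [l.IsCountablyGenerated] {s B : ℝ}
    (hl : l ≤ 𝓝 s) (h : ∀ᶠ θ in l, θ ∈ F.Θ ∧ F.b θ ≤ B) :
    Integrable (fun x : ℝ => Real.exp (s * x)) F.ξ := by
  refine ⟨by fun_prop, ?_⟩
  rw [hasFiniteIntegral_iff_ofReal (ae_of_all _ fun x => (Real.exp_pos _).le)]
  have hlim : ∀ x : ℝ, liminf (fun θ => ENNReal.ofReal (Real.exp (θ * x))) l =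
      ENNReal.ofReal (Real.exp (s * x)) := fun x => by
    refine Tendsto.liminf_eq (Tendsto.mono_left ?_ hl)
    have : Continuous fun θ : ℝ => ENNReal.ofReal (Real.exp (θ * x)) :=
      ENNReal.continuous_ofReal.comp (by fun_prop)
    exact this.tendsto s
  -- Fatou's lemma along `l`.
  calc ∫⁻ x, ENNReal.ofReal (Real.exp (s * x)) ∂F.ξ
      = ∫⁻ x, liminf (fun θ => ENNReal.ofReal (Real.exp (θ * x))) l ∂F.ξ := by simp_rw [hlim]
    _ ≤ liminf (fun θ => ∫⁻ x, ENNReal.ofReal (Real.exp (θ * x)) ∂F.ξ) l :=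
        lintegral_liminf_le fun θ => by fun_prop
    _ ≤ liminf (fun _ => ENNReal.ofReal (Real.exp B)) l := by
        refine liminf_le_liminf ?_
        filter_upwards [h] with θ ⟨hθ, hB⟩
        rw [lintegral_exp_mul hθ]
        exact ENNReal.ofReal_le_ofReal (Real.exp_le_exp.2 hB)
    _ < ⊤ := by rw [liminf_const]; exact ENNReal.ofReal_lt_top

lemma d_mean_mean {θ₀ θ : ℝ} (hθ₀ : θ₀ ∈ F.Θ) (hθ : θ ∈ F.Θ) :
    F.d (F.mean θ₀) (F.mean θ) = F.b θ - F.b θ₀ - F.mean θ₀ * (θ - θ₀) := by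
  rw [F.d_eq (F.mean_mem_O hθ₀), F.paramOf_mean hθ₀, F.paramOf_mean hθ]

lemma exists_mem_lt {θ : ℝ} (hθ : θ ∈ F.Θ) : ∃ t ∈ F.Θ, t < θ := by
  obtain ⟨l, r, ⟨hl, hr⟩, hlr⟩ := mem_nhds_iff_exists_Ioo_subset.1 (F.isOpen_Θ.mem_nhds hθ)
  exact ⟨(l + θ) / 2, hlr ⟨by linarith, by linarith⟩, by linarith⟩

lemma exists_mem_gt {θ : ℝ} (hθ : θ ∈ F.Θ) : ∃ t ∈ F.Θ, θ < t := by
  obtain ⟨l, r, ⟨hl, hr⟩, hlr⟩ := mem_nhds_iff_exists_Ioo_subset.1 (F.isOpen_Θ.mem_nhds hθ)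
  exact ⟨(θ + r) / 2, hlr ⟨by linarith, by linarith⟩, by linarith⟩

/-- Otherwise `b` lies below a line of slope `mean θ₀` to the right of `θ₀`. If `Θ` is bounded
above, `b` is bounded near its supremum, which then belongs to the open set `Θ`. If not, the tangent
at some `θ₁ > θ₀` has larger slope and overtakes the line. -/
lemma IsRegular.exists_le_d_upper (hF : F.IsRegular) {θ₀ : ℝ} (hθ₀ : θ₀ ∈ F.Θ) (v : ℝ) :
    ∃ q ∈ F.O, F.mean θ₀ < q ∧ v ≤ F.d (F.mean θ₀) q := by
  by_contra! hcon
  have hb : ∀ θ ∈ F.Θ, θ₀ < θ → F.b θ < F.b θ₀ + F.mean θ₀ * (θ - θ₀) + v := fun θ hθ hlt => by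
    have h := hcon _ (F.mean_mem_O hθ) (F.strictMonoOn_mean hθ₀ hθ hlt)
    rw [d_mean_mean hθ₀ hθ] at h
    linarith
  obtain ⟨θ₁, hθ₁, hlt₁⟩ := exists_mem_gt hθ₀
  by_cases hbdd : BddAbove F.Θ
  · set s := sSup F.Θ
    have hs : θ₀ < s := hlt₁.trans_le (le_csSup hbdd hθ₁)
    have hmem : s ∈ F.Θ := by
      refine hF s (integrable_exp_of_bounded (l := 𝓝[<] s)
        (B := F.b θ₀ + |F.mean θ₀| * (s - θ₀) + v) nhdsWithin_le_nhds ?_)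
      filter_upwards [Ioo_mem_nhdsLT hs] with θ hθ
      obtain ⟨t, ht, hθt⟩ := exists_lt_of_lt_csSup ⟨θ₀, hθ₀⟩ hθ.2
      have hθΘ : θ ∈ F.Θ := F.convex_Θ.ordConnected.out hθ₀ ht ⟨hθ.1.le, hθt.le⟩
      refine ⟨hθΘ, ?_⟩
      nlinarith [hb θ hθΘ hθ.1, hθ.1, hθ.2, le_abs_self (F.mean θ₀), abs_nonneg (F.mean θ₀)]
    obtain ⟨t, ht, hst⟩ := exists_mem_gt hmem
    exact absurd (le_csSup hbdd ht) (not_le.2 hst)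
  · have hslope := F.strictMonoOn_mean hθ₀ hθ₁ hlt₁
    obtain ⟨θ, hθ, hlt⟩ := not_bddAbove_iff.1 hbdd (θ₁ + |v| / (F.mean θ₁ - F.mean θ₀))
    rw [← sub_pos] at hslope
    have hpos : 0 ≤ |v| / (F.mean θ₁ - F.mean θ₀) := by positivity
    have h1 : |v| < (F.mean θ₁ - F.mean θ₀) * (θ - θ₁) := by
      rw [← div_lt_iff₀' hslope]
      linarith
    have h2 := hb θ hθ (by linarith)
    have h3 := F.mean_mul_sub_le hθ₁ hθ
    have h4 := F.mean_mul_sub_le hθ₀ hθ₁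
    nlinarith [le_abs_self v]

lemma IsRegular.exists_le_d_lower (hF : F.IsRegular) {θ₀ : ℝ} (hθ₀ : θ₀ ∈ F.Θ) (v : ℝ) :
    ∃ q ∈ F.O, q < F.mean θ₀ ∧ v ≤ F.d (F.mean θ₀) q := by
  by_contra! hcon
  have hb : ∀ θ ∈ F.Θ, θ < θ₀ → F.b θ < F.b θ₀ + F.mean θ₀ * (θ - θ₀) + v := fun θ hθ hlt => by
    have h := hcon _ (F.mean_mem_O hθ) (F.strictMonoOn_mean hθ hθ₀ hlt)
    rw [d_mean_mean hθ₀ hθ] at h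
    linarith
  obtain ⟨θ₁, hθ₁, hlt₁⟩ := exists_mem_lt hθ₀
  by_cases hbdd : BddBelow F.Θ
  · set s := sInf F.Θ
    have hs : s < θ₀ := (csInf_le hbdd hθ₁).trans_lt hlt₁
    have hmem : s ∈ F.Θ := by
      refine hF s (integrable_exp_of_bounded (l := 𝓝[>] s)
        (B := F.b θ₀ + |F.mean θ₀| * (θ₀ - s) + v) nhdsWithin_le_nhds ?_)
      filter_upwards [Ioo_mem_nhdsGT hs] with θ hθ
      obtain ⟨t, ht, hθt⟩ := exists_lt_of_csInf_lt ⟨θ₀, hθ₀⟩ hθ.1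
      have hθΘ : θ ∈ F.Θ := F.convex_Θ.ordConnected.out ht hθ₀ ⟨hθt.le, hθ.2.le⟩
      refine ⟨hθΘ, ?_⟩
      nlinarith [hb θ hθΘ hθ.2, hθ.1, hθ.2, neg_abs_le (F.mean θ₀), abs_nonneg (F.mean θ₀)]
    obtain ⟨t, ht, hst⟩ := exists_mem_lt hmem
    exact absurd (csInf_le hbdd ht) (not_le.2 hst)
  · have hslope := F.strictMonoOn_mean hθ₁ hθ₀ hlt₁
    obtain ⟨θ, hθ, hlt⟩ := not_bddBelow_iff.1 hbdd (θ₁ - |v| / (F.mean θ₀ - F.mean θ₁))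
    rw [← sub_pos] at hslope
    have hpos : 0 ≤ |v| / (F.mean θ₀ - F.mean θ₁) := by positivity
    have h1 : |v| < (F.mean θ₀ - F.mean θ₁) * (θ₁ - θ) := by
      rw [← div_lt_iff₀' hslope]
      linarith
    have h2 := hb θ hθ (by linarith)
    have h3 := F.mean_mul_sub_le hθ₁ hθ
    have h4 := F.mean_mul_sub_le hθ₀ hθ₁
    nlinarith [le_abs_self v]

lemma IsRegular.reaches (hF : F.IsRegular) {θ₀ : ℝ} (hθ₀ : θ₀ ∈ F.Θ) (v : ℝ) :
    F.Reaches (F.mean θ₀) v :=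
  ⟨hF.exists_le_d_lower hθ₀ v, hF.exists_le_d_upper hθ₀ v⟩

end ExpFamily

/-! ### The limit of `β(n, δ) / n`. -/

section Limits

variable {C : ℝ → ℝ} {cbar μ : ℝ}

lemma tendsto_fst_samplingFilter :
    Tendsto (fun p : ℝ × ℕ × ℝ => p.1) (samplingFilter C cbar μ) (𝓝[>] 0) :=
  tendsto_comap.mono_left (inf_le_left.trans inf_le_left)

lemma tendsto_count_div_samplingFilter :
    Tendsto (fun p : ℝ × ℕ × ℝ => (p.2.1 : ℝ) / C p.1) (samplingFilter C cbar μ) (𝓝 cbar⁻¹) :=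
  tendsto_comap.mono_left (inf_le_left.trans inf_le_right)

lemma tendsto_mean_samplingFilter :
    Tendsto (fun p : ℝ × ℕ × ℝ => p.2.2) (samplingFilter C cbar μ) (𝓝 μ) :=
  tendsto_comap.mono_left inf_le_right

lemma tendsto_count_samplingFilter (hcbar : 0 < cbar) (hC : Tendsto C (𝓝[>] 0) atTop) :
    Tendsto (fun p : ℝ × ℕ × ℝ => (p.2.1 : ℝ)) (samplingFilter C cbar μ) atTop := by
  have hC' := hC.comp (tendsto_fst_samplingFilter (C := C) (cbar := cbar) (μ := μ))
  refine (tendsto_count_div_samplingFilter.pos_mul_atTop (inv_pos.2 hcbar) hC').congr' ?_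
  filter_upwards [hC'.eventually_gt_atTop 0] with p hp
  exact div_mul_cancel₀ _ hp.ne'

lemma tendsto_log_inv : Tendsto (fun δ : ℝ => Real.log (1 / δ)) (𝓝[>] 0) atTop := by
  simp only [one_div]
  exact Real.tendsto_log_atTop.comp tendsto_inv_nhdsGT_zero

lemma tendsto_log_one_add_log_div :
    Tendsto (fun x : ℝ => Real.log (1 + Real.log x) / x) atTop (𝓝 0) := by
  refine squeeze_zero' ?_ ?_ tendsto_log_div_atTop
  · filter_upwards [eventually_ge_atTop 1] with x hx
    exact div_nonneg (Real.log_nonneg (by linarith [Real.log_nonneg hx])) (by linarith)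
  · filter_upwards [eventually_ge_atTop 1] with x hx
    have := Real.log_nonneg hx
    gcongr
    linarith [Real.log_le_sub_one_of_pos (show 0 < x by linarith)]

/-- The splitting isolates factors with known limits: the iterated logarithm vanishes, `calT L / L →
1` for `L = log (1 / δ)`, and `C / n → cbar`. -/
lemma beta_div_eventuallyEq (hC : Tendsto C (𝓝[>] 0) atTop) :
    (fun p : ℝ × ℕ × ℝ => 3 * (Real.log (1 + Real.log (p.2.1 : ℝ)) / p.2.1) +
      calT (Real.log (1 / p.1)) / Real.log (1 / p.1) *
        (((p.2.1 : ℝ) / C p.1)⁻¹ * (Real.log (1 / p.1) / C p.1)))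
    =ᶠ[samplingFilter C cbar μ] fun p => beta p.2.1 p.1 / p.2.1 := by
  filter_upwards [(hC.comp tendsto_fst_samplingFilter).eventually_gt_atTop 0,
    (tendsto_log_inv.comp tendsto_fst_samplingFilter).eventually_gt_atTop 0] with p h1 h2
  simp only [Function.comp_apply] at h1 h2
  rw [beta, inv_div]
  field_simp

lemma tendsto_log_term_samplingFilter (hcbar : 0 < cbar) (hC : Tendsto C (𝓝[>] 0) atTop) :
    Tendsto (fun p : ℝ × ℕ × ℝ => 3 * (Real.log (1 + Real.log (p.2.1 : ℝ)) / p.2.1))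
      (samplingFilter C cbar μ) (𝓝 0) := by
  simpa using (tendsto_log_one_add_log_div.comp
    (tendsto_count_samplingFilter (μ := μ) hcbar hC)).const_mul 3

lemma tendsto_beta_div (hcbar : 0 < cbar) (hC : Tendsto C (𝓝[>] 0) atTop) {ρ : ℝ}
    (hρ : Tendsto (fun δ => Real.log (1 / δ) / C δ) (𝓝[>] 0) (𝓝 ρ)) :
    Tendsto (fun p : ℝ × ℕ × ℝ => beta p.2.1 p.1 / p.2.1) (samplingFilter C cbar μ)
      (𝓝 (cbar * ρ)) := by
  have h := (tendsto_log_term_samplingFilter (μ := μ) hcbar hC).add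
    ((tendsto_calT_div.comp (tendsto_log_inv.comp tendsto_fst_samplingFilter)).mul
      ((tendsto_count_div_samplingFilter.inv₀ (inv_ne_zero hcbar.ne')).mul
        (hρ.comp tendsto_fst_samplingFilter)))
  rw [inv_inv, one_mul, zero_add] at h
  exact h.congr' (beta_div_eventuallyEq hC)

lemma tendsto_beta_div_atTop (hcbar : 0 < cbar) (hC : Tendsto C (𝓝[>] 0) atTop)
    (hρ : Tendsto (fun δ => Real.log (1 / δ) / C δ) (𝓝[>] 0) atTop) :
    Tendsto (fun p : ℝ × ℕ × ℝ => beta p.2.1 p.1 / p.2.1) (samplingFilter C cbar μ) atTop := by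
  have hinv : Tendsto (fun p : ℝ × ℕ × ℝ => ((p.2.1 : ℝ) / C p.1)⁻¹) (samplingFilter C cbar μ)
      (𝓝 cbar) := by
    simpa using tendsto_count_div_samplingFilter.inv₀ (inv_ne_zero hcbar.ne')
  exact ((tendsto_log_term_samplingFilter (μ := μ) hcbar hC).add_atTop
    ((tendsto_calT_div.comp (tendsto_log_inv.comp tendsto_fst_samplingFilter)).pos_mul_atTop one_pos
      (hinv.pos_mul_atTop hcbar (hρ.comp tendsto_fst_samplingFilter)))).congr'
    (beta_div_eventuallyEq hC)

end Limits

/-! ### The limiting confidence interval in each regime. -/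

section LimitingInterval

variable {F : ExpFamily}

lemma natCast_mul_dExt_le_iff {n : ℕ} (hn : 0 < n) {x : ℝ} (hx : x ∈ F.O) (q β : ℝ) :
    (n : EReal) * F.dExt x q ≤ (β : EReal) ↔
      ((F.d x q : ℝ) : EReal) ≤ ((β / n : ℝ) : EReal) := by
  have hn' : (0 : ℝ) < n := by exact_mod_cast hn
  have hcast : (n : EReal) * ((F.d x q : ℝ) : EReal) = ((n * F.d x q : ℝ) : EReal) := by
    rw [EReal.coe_mul]
    rfl
  rw [F.dExt_of_mem hx, hcast, EReal.coe_le_coe_iff, EReal.coe_le_coe_iff, le_div_iff₀' hn']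

lemma piHat_upper_eq {n : ℕ} (hn : 0 < n) (x : Fin n → ℝ) (δ : ℝ) (hx : sampleMean x ∈ F.O) :
    (piHat F).upper n x δ = F.upperLevel (sampleMean x) ((beta n δ / n : ℝ) : EReal) := by
  simp only [piHat, if_neg hn.ne', ExpFamily.upperLevel, natCast_mul_dExt_le_iff hn hx]

lemma piHat_lower_eq {n : ℕ} (hn : 0 < n) (x : Fin n → ℝ) (δ : ℝ) (hx : sampleMean x ∈ F.O) :
    (piHat F).lower n x δ = F.lowerLevel (sampleMean x) ((beta n δ / n : ℝ) : EReal) := by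
  simp only [piHat, if_neg hn.ne', ExpFamily.lowerLevel, natCast_mul_dExt_le_iff hn hx]

variable {Ω : Type*} [MeasurableSpace Ω] {P : Measure Ω} {X c : ℕ → Ω → ℝ} {κ : Measure ℝ}
  {cbar θ : ℝ} {C : ℝ → ℝ}

/-- All regimes reduce to the deterministic limit of `β / n`: eventually the sample mean is in `O`,
where the extended divergence is `d` and the end points are the level functions. -/
lemma hasLimitingCI_piHat (hθ : θ ∈ F.Θ) (h : IsCostlySampling P X c (F.law θ) κ cbar)
    (hC : Tendsto C (𝓝[>] 0) atTop) {v : EReal}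
    (hv : Tendsto (fun p : ℝ × ℕ × ℝ => ((beta p.2.1 p.1 / p.2.1 : ℝ) : EReal))
      (samplingFilter C cbar (F.mean θ)) (𝓝 v)) :
    HasLimitingCI (piHat F) P X c C (F.mean θ) (F.lowerLevel (F.mean θ) v)
      (F.upperLevel (F.mean θ) v) := by
  have hO := F.mean_mem_O hθ
  have hreg : ∀ᶠ p : ℝ × ℕ × ℝ in samplingFilter C cbar (F.mean θ), 0 < p.2.1 ∧ p.2.2 ∈ F.O := by
    filter_upwards [(tendsto_count_samplingFilter h.cbar_pos hC).eventually_gt_atTop 0,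
      tendsto_mean_samplingFilter.eventually (F.isOpen_O.mem_nhds hO)] with p h1 h2
    exact ⟨by exact_mod_cast h1, h2⟩
  refine ⟨F.lowerLevel_le _ _, F.le_upperLevel _ _, fun U hU => ?_, fun U hU => ?_⟩
  · have hE := (ExpFamily.tendsto_lowerLevel hO tendsto_mean_samplingFilter hv).eventually hU
    refine tendsto_of_tendsto_of_tendsto_of_le_of_le tendsto_const_nhds
      (tendsto_measure_notMem_samplingFilter h (F.integrable_id_law hθ) hC (hreg.and hE))
      (fun δ => bot_le) fun δ => measure_mono fun ω hω hmem => hω ?_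
    obtain ⟨⟨hn, hx⟩, hlim⟩ := hmem
    change lowerAt (piHat F) X c (C δ) δ ω ∈ U
    rw [lowerAt, piHat_lower_eq hn _ _ (by rw [sampleMean_eq_runMean]; exact hx),
      sampleMean_eq_runMean]
    exact hlim
  · have hE := (ExpFamily.tendsto_upperLevel hO tendsto_mean_samplingFilter hv).eventually hU
    refine tendsto_of_tendsto_of_tendsto_of_le_of_le tendsto_const_nhds
      (tendsto_measure_notMem_samplingFilter h (F.integrable_id_law hθ) hC (hreg.and hE))
      (fun δ => bot_le) fun δ => measure_mono fun ω hω hmem => hω ?_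
    obtain ⟨⟨hn, hx⟩, hlim⟩ := hmem
    change upperAt (piHat F) X c (C δ) δ ω ∈ U
    rw [upperAt, piHat_upper_eq hn _ _ (by rw [sampleMean_eq_runMean]; exact hx),
      sampleMean_eq_runMean]
    exact hlim

/-- The limit when `C δ / log (1/δ)` tends to a positive real number. -/
lemma hasLimitingCI_of_tendsto (hθ : θ ∈ F.Θ) (h : IsCostlySampling P X c (F.law θ) κ cbar)
    (hC : Tendsto C (𝓝[>] 0) atTop) {k : ℝ} (hk : 0 < k)
    (hlim : Tendsto (fun δ => C δ / Real.log (1 / δ)) (𝓝[>] 0) (𝓝 k)) :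
    HasLimitingCI (piHat F) P X c C (F.mean θ) (F.lowerLevel (F.mean θ) ((cbar / k : ℝ) : EReal))
      (F.upperLevel (F.mean θ) ((cbar / k : ℝ) : EReal)) := by
  refine hasLimitingCI_piHat hθ h hC ((continuous_coe_real_ereal.tendsto _).comp ?_)
  exact tendsto_beta_div h.cbar_pos hC (by simpa only [inv_div] using hlim.inv₀ hk.ne')

/-- The limit when `C δ / log (1/δ)` tends to infinity. -/
lemma hasLimitingCI_of_tendsto_atTop (hθ : θ ∈ F.Θ)
    (h : IsCostlySampling P X c (F.law θ) κ cbar) (hC : Tendsto C (𝓝[>] 0) atTop)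
    (hlim : Tendsto (fun δ => C δ / Real.log (1 / δ)) (𝓝[>] 0) atTop) :
    HasLimitingCI (piHat F) P X c C (F.mean θ) ((F.mean θ : ℝ) : EReal)
      ((F.mean θ : ℝ) : EReal) := by
  have hO := F.mean_mem_O hθ
  have hρ : Tendsto (fun δ => Real.log (1 / δ) / C δ) (𝓝[>] 0) (𝓝 0) :=
    hlim.inv_tendsto_atTop.congr fun δ => by rw [Pi.inv_apply, inv_div]
  have hb := tendsto_beta_div (μ := F.mean θ) h.cbar_pos hC hρ
  rw [mul_zero] at hb
  have hci := hasLimitingCI_piHat hθ h hC ((continuous_coe_real_ereal.tendsto _).comp hb)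
  rwa [ExpFamily.lowerLevel_eq_of_d_eq hO hO le_rfl (F.d_self _),
    ExpFamily.upperLevel_eq_of_d_eq hO hO le_rfl (F.d_self _)] at hci

/-- The limit when `C δ / log (1/δ)` tends to zero. -/
lemma hasLimitingCI_of_tendsto_zero (hθ : θ ∈ F.Θ)
    (h : IsCostlySampling P X c (F.law θ) κ cbar) (hC : Tendsto C (𝓝[>] 0) atTop)
    (hlim : Tendsto (fun δ => C δ / Real.log (1 / δ)) (𝓝[>] 0) (𝓝 0)) :
    HasLimitingCI (piHat F) P X c C (F.mean θ) (F.lowerLevel (F.mean θ) ⊤)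
      (F.upperLevel (F.mean θ) ⊤) := by
  refine hasLimitingCI_piHat hθ h hC (EReal.tendsto_coe_nhds_top_iff.2 ?_)
  refine tendsto_beta_div_atTop h.cbar_pos hC ?_
  -- Approach to `0` from above makes the reciprocal tend to `+∞`.
  have hpos : ∀ᶠ δ in 𝓝[>] (0 : ℝ), C δ / Real.log (1 / δ) ∈ Ioi 0 := by
    filter_upwards [hC.eventually_gt_atTop 0, tendsto_log_inv.eventually_gt_atTop 0] with δ h1 h2
    exact div_pos h1 h2
  exact (tendsto_inv_nhdsGT_zero.comp (tendsto_nhdsWithin_iff.2 ⟨hlim, hpos⟩)).congr fun δ => by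
    rw [Function.comp_apply, inv_div]

lemma exists_hasLimitingCI (hθ : θ ∈ F.Θ) (h : IsCostlySampling P X c (F.law θ) κ cbar)
    (hC : Tendsto C (𝓝[>] 0) atTop) {k : EReal}
    (hk : Tendsto (fun δ => ((C δ / Real.log (1 / δ) : ℝ) : EReal)) (𝓝[>] 0) (𝓝 k)) :
    ∃ L R : EReal, HasLimitingCI (piHat F) P X c C (F.mean θ) L R := by
  have hk0 : 0 ≤ k := by
    refine ge_of_tendsto hk ?_
    filter_upwards [hC.eventually_gt_atTop 0, tendsto_log_inv.eventually_gt_atTop 0] with δ h1 h2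
    exact_mod_cast (div_pos h1 h2).le
  induction k with
  | bot => simp at hk0
  | top => exact ⟨_, _, hasLimitingCI_of_tendsto_atTop hθ h hC (EReal.tendsto_coe_nhds_top_iff.1 hk)⟩
  | coe k =>
    have hk' := EReal.tendsto_coe.1 hk
    rcases (EReal.coe_nonneg.1 hk0).eq_or_lt with rfl | hpos
    · exact ⟨_, _, hasLimitingCI_of_tendsto_zero hθ h hC hk'⟩
    · exact ⟨_, _, hasLimitingCI_of_tendsto hθ h hC hpos hk'⟩

end LimitingInterval

end CIMean

theorem theorem4 (F : CIMean.ExpFamily) :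
    -- (a) the policy is valid and stable
    CIMean.piHat F ∈ CIMean.stablePolicies.{u} F ∧
    ∀ (Ω : Type u) [MeasurableSpace Ω] (P : Measure Ω) (X c : ℕ → Ω → ℝ) (κ : Measure ℝ)
      (cbar θ : ℝ), θ ∈ F.Θ → CIMean.IsCostlySampling P X c (F.law θ) κ cbar →
      ∀ C : ℝ → ℝ, Tendsto C (𝓝[>] 0) atTop →
        -- (b) the sufficient learning regime
        (∀ k : ℝ, 0 < k → Tendsto (fun δ => C δ / Real.log (1 / δ)) (𝓝[>] 0) (𝓝 k) →
          (F.IsRegular ∨ F.Reaches (F.mean θ) (cbar / k)) →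
          ∃ qL qR : ℝ, F.SolvesSystem (F.mean θ) (cbar / k) qL qR ∧
            (∀ qL' qR' : ℝ, F.SolvesSystem (F.mean θ) (cbar / k) qL' qR' →
              qL' = qL ∧ qR' = qR) ∧
            CIMean.HasLimitingCI (CIMean.piHat F) P X c C (F.mean θ) (qL : EReal) (qR : EReal)) ∧
        -- (c) the complete learning regime
        (Tendsto (fun δ => C δ / Real.log (1 / δ)) (𝓝[>] 0) atTop →
          ∃ L R : ℝ,
            CIMean.HasLimitingCI (CIMean.piHat F) P X c C (F.mean θ) (L : EReal) (R : EReal) ∧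
            R - L = 0) := by
  open CIMean in
  refine ⟨⟨?_, ?_⟩, ?_⟩
  · intro Ω _ P X c κ cbar θ hθ h C δ hδ
    exact piHat_coverage hθ h (C δ) hδ
  · intro Ω _ P X c κ cbar θ hθ h C hC ⟨k, hk⟩
    exact exists_hasLimitingCI hθ h hC hk
  · intro Ω _ P X c κ cbar θ hθ h C hC
    have hO := F.mean_mem_O hθ
    refine ⟨fun k hk hlim hreach => ?_, fun hlim => ?_⟩
    · have hr : F.Reaches (F.mean θ) (cbar / k) :=
        hreach.elim (fun hF => hF.reaches hθ _) id
      obtain ⟨qL, qR, hsol⟩ := ExpFamily.exists_solvesSystem hO (div_pos h.cbar_pos hk) hr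
      refine ⟨qL, qR, hsol, fun qL' qR' h' => hsol.unique hO h', ?_⟩
      have hci := hasLimitingCI_of_tendsto hθ h hC hk hlim
      obtain ⟨hL, hR, hLm, hmR, hRv, hLv⟩ := hsol
      rwa [ExpFamily.lowerLevel_eq_of_d_eq hO hL hLm.le hLv,
        ExpFamily.upperLevel_eq_of_d_eq hO hR hmR.le hRv] at hci
    · exact ⟨_, _, hasLimitingCI_of_tendsto_atTop hθ h hC hlim, sub_self _⟩
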